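/- Let $K$ be a field of characteristic $0$ and let $(\mathfrak g,\cdot)$ be a finite-dimensional pre-Lie algebra over $K$, i.e. $\cdot$ is bilinear and $(x\cdot y)\cdot z-x\cdot(y\cdot z)$ is symmetric in $x,y$. Let $[x,y]=x\cdot y-y\cdot x$ be the bracket of its sub-adjacent Lie algebra, and let $L^*$ be the representation of this Lie algebra on $\mathfrak g^*$ given by $\langle L^*_x\alpha,y\rangle=-\langle\alpha,x\cdot y\rangle$. For $P\in\mathrm{Hom}(\wedge^n\mathfrak g^*,\mathfrak g)$ and $Q\in\mathrm{Hom}(\wedge^m\mathfrak g^*,\mathfrak g)$ define $[\![P,Q]\!]\in\mathrm{Hom}(\wedge^{n+m}\mathfrak g^*,\mathfrak g)$ by $$\begin{aligned}[\![P,Q]\!](\alpha_1,\dots,\alpha_{m+n})=&\sum_{\sigma\in S_{(m,1,n-1)}}(-1)^\sigma P\big(L^*_{Q(\alpha_{\sigma(1)},\dots,\alpha_{\sigma(m)})}\alpha_{\sigma(m+1)},\alpha_{\sigma(m+2)},\dots,\alpha_{\sigma(m+n)}\big)\\&-(-1)^{mn}\sum_{\sigma\in S_{(n,1,m-1)}}(-1)^\sigma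 Q\big(L^*_{P(\alpha_{\sigma(1)},\dots,\alpha_{\sigma(n)})}\alpha_{\sigma(n+1)},\alpha_{\sigma(n+2)},\dots,\alpha_{\sigma(m+n)}\big)\\&+(-1)^{mn}\sum_{\sigma\in S_{(n,m)}}(-1)^\sigma\big[P(\alpha_{\sigma(1)},\dots,\alpha_{\sigma(n)}),Q(\alpha_{\sigma(n+1)},\dots,\alpha_{\sigma(m+n)})\big],\end{aligned}$$ the sums being over shuffles (a sum over $S_{(m,1,-1)}$ or $S_{(n,1,-1)}$ is zero). For $k\ge 0$ let $\Psi:\wedge^k\mathfrak g\otimes\mathfrak g\to\mathrm{Hom}(\wedge^k\mathfrak g^*,\mathfrak g)$ be the isomorphism $\langle\Psi(\varphi)(\alpha_1,\dots,\alpha_k),\alpha_{k+1}\rangle=\langle\varphi,\alpha_1\wedge\dots\wedge\alpha_k\otimes\alpha_{k+1}\rangle$, where $\langle x_1\wedge\dots\wedge x_k,\alpha_1\wedge\dots\wedge\alpha_k\rangle=\det(\langle x_i,\alpha_j\rangle)$, let $\Upsilon=\Psi^{-1}$, and write $\varphi(\alpha_1,\dots,\alpha_{k+1})$ for $\langle\varphi,\alpha_1\wedge\dots\wedge\alpha_k\otimes\alpha_{k+1}\rangle$.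 (1) The bilinear operation $[\![\varphi,\phi]\!]_{\mathfrak s}=\Upsilon[\![\Psi(\varphi),\Psi(\phi)]\!]$ is a graded Lie bracket on $\bigoplus_{k\ge0}\wedge^k\mathfrak g\otimes\mathfrak g$, where $\wedge^k\mathfrak g\otimes\mathfrak g$ has degree $k$. (2) For $r=\sum_i a_i\otimes b_i\in\mathfrak g\otimes\mathfrak g$ put $$[r,r]=-\sum_{i,j}a_i\cdot a_j\otimes b_i\otimes b_j+\sum_{i,j}a_i\otimes b_i\cdot a_j\otimes b_j+\sum_{i,j}a_i\otimes a_j\otimes[b_i,b_j].$$ A symmetric tensor $r\in\mathrm{Sym}^2(\mathfrak g)$ is an $\mathfrak s$-matrix, i.e. $[r,r]=0$, if and only if $r$, viewed in $\wedge^1\mathfrak g\otimes\mathfrak g$, is a Maurer–Cartan element of the graded Lie algebra in (1), i.e. $\tfrac12[\![r,r]\!]_{\mathfrak s}=0$. More precisely, for every $r\in\mathrm{Sym}^2(\mathfrak g)$ and all $\alpha_1,\alpha_2,\alpha_3\in\mathfrak g^*$, $$[\![r,r]\!]_{\mathfrak s}(\alpha_1,\alpha_2,\alpha_3)=-2\,[r,r](\alpha_1,\alpha_2,\alpha_3).$$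 -/

import Mathlib

open scoped TensorProduct DirectSum

namespace SMatrix

set_option linter.unusedSectionVars false

/-! ### Shuffles -/

section Shuffle

/-- Cut `{0, …, N - 1}` into the consecutive blocks of lengths `p`, `q`, `N - p - q`, numbered
`0`, `1`, `2`. -/
def block {N : ℕ} (p q : ℕ) (i : Fin N) : ℕ :=
  if (i : ℕ) < p then 0 else if (i : ℕ) < p + q then 1 else 2

/-- The set `S_(p, q, N - p - q)` of shuffles: the permutations of `{0, …, N - 1}` which are
increasing on each of the three consecutive blocks of lengths `p`, `q`, `N - p - q`. -/
def shuffles (N p q : ℕ) : Finset (Equiv.Perm (Fin N)) :=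
  Finset.univ.filter fun σ => ∀ i j, i < j → block p q i = block p q j → σ i < σ j

theorem block_monotone {N : ℕ} (p q : ℕ) : Monotone (block (N := N) p q) := by
  intro i j hij
  have : (i : ℕ) ≤ j := hij
  unfold block
  split_ifs <;> omega

theorem shuffle_unique {N p q : ℕ} {σ y : Equiv.Perm (Fin N)} (hσ : σ ∈ shuffles N p q)
    (hσy : σ * y ∈ shuffles N p q) (hy : ∀ i, block p q (y i) = block p q i) : y = 1 := by
  simp only [shuffles, Finset.mem_filter, Finset.mem_univ, true_and] at hσ hσy
  have key : ∀ i j, i < j → y i < y j := by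
    intro i j hij
    by_contra hcon
    have hne : y i ≠ y j := fun h => hij.ne (y.injective h)
    have hlt : y j < y i := lt_of_le_of_ne (not_lt.mp hcon) hne.symm
    have h1 : block p q i ≤ block p q j := block_monotone p q hij.le
    have h2 : block p q (y j) ≤ block p q (y i) := block_monotone p q hlt.le
    rw [hy, hy] at h2
    have hb := le_antisymm h1 h2
    have h3 := hσy i j hij hb
    have h4 := hσ (y j) (y i) hlt (by rw [hy, hy, hb])
    exact lt_asymm h3 h4
  have hm : StrictMono y := fun i j h => key i j h
  ext i
  have := Subsingleton.elim (hm.orderIsoOfSurjective _ y.surjective) (OrderIso.refl _)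
  have h := congrArg (fun e : Fin N ≃o Fin N => e i) this
  simpa using congrArg Fin.val h

theorem shuffle_exists {N : ℕ} (p q : ℕ) (τ : Equiv.Perm (Fin N)) :
    ∃ y : Equiv.Perm (Fin N), (∀ i, block p q (y i) = block p q i) ∧ τ * y ∈ shuffles N p q := by
  let κ : Fin N → ℕ ×ₗ Fin N := fun i => toLex (block p q i, τ i)
  have hm : Monotone (κ ∘ Tuple.sort κ) := Tuple.monotone_sort κ
  refine ⟨Tuple.sort κ, ?_, ?_⟩
  · have h1 : Monotone (block p q ∘ Tuple.sort κ) := by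
      intro i j hij
      have := hm hij
      simp only [κ, Function.comp, Prod.Lex.toLex_le_toLex] at this ⊢
      rcases this with h | h
      · exact h.le
      · exact h.1.le
    have h2 : Monotone (block p q ∘ (1 : Equiv.Perm (Fin N))) := block_monotone p q
    have := Tuple.unique_monotone h1 h2
    exact fun i => congrFun this i
  · simp only [shuffles, Finset.mem_filter, Finset.mem_univ, true_and]
    intro i j hij hb
    have h1 : Monotone (block p q ∘ Tuple.sort κ) := by
      intro i j hij
      have := hm hij
      simp only [κ, Function.comp, Prod.Lex.toLex_le_toLex] at this ⊢
      rcases this with h | h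
      · exact h.le
      · exact h.1.le
    have h2 : Monotone (block p q ∘ (1 : Equiv.Perm (Fin N))) := block_monotone p q
    have h3 := Tuple.unique_monotone h1 h2
    have hbi : block p q (Tuple.sort κ i) = block p q (Tuple.sort κ j) := by
      have e1 := congrFun h3 i
      have e2 := congrFun h3 j
      simp only [Function.comp, Equiv.Perm.coe_one, id] at e1 e2
      rw [e1, e2, hb]
    have := hm hij.le
    simp only [κ, Function.comp, Prod.Lex.toLex_le_toLex] at this
    rcases this with h | h
    · exact absurd hbi h.ne
    · refine lt_of_le_of_ne h.2 fun h' => hij.ne ?_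
      exact (Tuple.sort κ).injective (τ.injective h')

theorem sum_perm_eq_card_nsmul {N : ℕ} (p q : ℕ) {M : Type*} [AddCommMonoid M]
    (f : Equiv.Perm (Fin N) → M)
    (hf : ∀ σ y : Equiv.Perm (Fin N), (∀ i, block p q (y i) = block p q i) → f (σ * y) = f σ) :
    ∑ τ, f τ = (Finset.univ.filter fun y : Equiv.Perm (Fin N) =>
      ∀ i, block p q (y i) = block p q i).card • ∑ σ ∈ shuffles N p q, f σ := by
  rw [← Finset.sum_const, ← Finset.sum_product']
  symm
  refine Finset.sum_bij (fun x _ => x.2 * x.1) (by simp) ?_ ?_ ?_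
  · rintro ⟨y, σ⟩ h ⟨y', σ'⟩ h' heq
    simp only [Finset.mem_product, Finset.mem_filter, Finset.mem_univ, true_and] at h h' heq
    have hσ' : σ' = σ * (y * y'⁻¹) := by rw [← mul_assoc, heq]; simp
    have hy' : ∀ i, block p q (y'⁻¹ i) = block p q i := fun i => by
      have := h'.1 (y'⁻¹ i)
      simpa using this.symm
    have h1 : y * y'⁻¹ = 1 := shuffle_unique h.2 (hσ' ▸ h'.2) fun i => by
      rw [Equiv.Perm.mul_apply, h.1, hy']
    have : y = y' := mul_inv_eq_one.mp h1
    subst this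
    simp at hσ'
    simp [hσ']
  · intro τ _
    obtain ⟨y, hy, hτ⟩ := shuffle_exists p q τ
    refine ⟨(y⁻¹, τ * y), ?_, by simp⟩
    simp only [Finset.mem_product, Finset.mem_filter, Finset.mem_univ, true_and]
    refine ⟨fun i => ?_, hτ⟩
    have := hy (y⁻¹ i)
    simpa using this.symm
  · rintro ⟨y, σ⟩ h
    simp only [Finset.mem_product, Finset.mem_filter, Finset.mem_univ, true_and] at h
    exact (hf σ y h.1).symm

end Shuffle

/-! ### The bracket on `⨁ₙ Hom(⋀ⁿ V, L)` for a representation `ρ` of a Lie algebra `L` on `V` -/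

section Bracket

variable {K L V : Type*} [Field K] [CharZero K] [LieRing L] [LieAlgebra K L]
  [AddCommGroup V] [Module K V]

/-- The alternating map `u ↦ ∑ (-1)^σ F(u_σ(1), …, u_σ(N))`, the sum being over the shuffles `σ`
with respect to the blocks of lengths `p`, `q`, `N - p - q`, for a multilinear map `F` which is
skew-symmetric within each block. -/
def shuffleSum {N : ℕ} (p q : ℕ) (F : MultilinearMap K (fun _ : Fin N => V) L)
    (hF : ∀ y : Equiv.Perm (Fin N), (∀ i, block p q (y i) = block p q i) →
      ∀ u : Fin N → V, F (u ∘ y) = Equiv.Perm.sign y • F u) : V [⋀^Fin N]→ₗ[K] L :=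
  { ∑ σ ∈ shuffles N p q, Equiv.Perm.sign σ • F.domDomCongr σ with
    map_eq_zero_of_eq' := by
      intro v i j hv hij
      have h0 : (MultilinearMap.alternatization F) v = 0 :=
        (MultilinearMap.alternatization F).map_eq_zero_of_eq v hv hij
      rw [MultilinearMap.alternatization_apply] at h0
      simp only [MultilinearMap.toFun_eq_coe, _root_.sum_apply,
        _root_.smul_apply] at h0 ⊢
      rw [sum_perm_eq_card_nsmul p q] at h0
      · rw [← Nat.cast_smul_eq_nsmul K] at h0
        refine (smul_eq_zero.mp h0).resolve_left ?_
        refine Nat.cast_ne_zero.mpr (Finset.card_pos.mpr ⟨1, ?_⟩).ne'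
        simp
      · intro σ y hy
        have h1 := hF y hy (v ∘ σ)
        simp only [MultilinearMap.domDomCongr_apply]
        change _ • F ((v ∘ σ) ∘ y) = _ • F (v ∘ σ)
        rw [h1, smul_smul, Equiv.Perm.sign_mul, mul_assoc, Int.units_mul_self, mul_one] }

theorem shuffleSum_apply {N : ℕ} (p q : ℕ) (F : MultilinearMap K (fun _ : Fin N => V) L)
    (hF : ∀ y : Equiv.Perm (Fin N), (∀ i, block p q (y i) = block p q i) →
      ∀ u : Fin N → V, F (u ∘ y) = Equiv.Perm.sign y • F u) (u : Fin N → V) :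
    shuffleSum p q F hF u =
      ∑ σ ∈ shuffles N p q, (Equiv.Perm.sign σ : ℤ) • F (fun i => u (σ i)) := by
  change (∑ σ ∈ shuffles N p q, Equiv.Perm.sign σ • F.domDomCongr σ) u = _
  simp only [_root_.sum_apply, _root_.smul_apply,
    MultilinearMap.domDomCongr_apply]
  rfl

/-- A permutation of `{0, …, m + n - 1}` which preserves the first `m` elements splits. -/
theorem exists_split {m n : ℕ} (y : Equiv.Perm (Fin (m + n)))
    (hy : ∀ i : Fin (m + n), (i : ℕ) < m → (y i : ℕ) < m) :
    ∃ (y₁ : Equiv.Perm (Fin m)) (y₂ : Equiv.Perm (Fin n)),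
      (∀ i, y (Fin.castAdd n i) = Fin.castAdd n (y₁ i)) ∧
      (∀ i, y (Fin.natAdd m i) = Fin.natAdd m (y₂ i)) ∧
      Equiv.Perm.sign y = Equiv.Perm.sign y₁ * Equiv.Perm.sign y₂ := by
  let z : Equiv.Perm (Fin m ⊕ Fin n) := finSumFinEquiv.symm.permCongr y
  have hz : Set.MapsTo z (Set.range Sum.inl) (Set.range Sum.inl) := by
    rintro _ ⟨i, rfl⟩
    have h := hy (Fin.castAdd n i) (by simp)
    refine ⟨⟨_, h⟩, ?_⟩
    simp only [z, Equiv.permCongr_apply, Equiv.symm_symm, finSumFinEquiv_apply_left]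
    rw [Equiv.eq_symm_apply, finSumFinEquiv_apply_left]
    rfl
  obtain ⟨⟨y₁, y₂⟩, h⟩ := Equiv.Perm.mem_sumCongrHom_range_of_perm_mapsTo_inl hz
  have hsum : z = Equiv.sumCongr y₁ y₂ := h.symm
  have hyz : ∀ x, y (finSumFinEquiv x) = finSumFinEquiv (z x) := by
    intro x
    simp [z, Equiv.permCongr_apply]
  refine ⟨y₁, y₂, fun i => ?_, fun i => ?_, ?_⟩
  · have := hyz (Sum.inl i)
    rw [hsum] at this
    simpa using this
  · have := hyz (Sum.inr i)
    rw [hsum] at this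
    simpa using this
  · rw [← Equiv.Perm.sign_sumCongr y₁ y₂]
    have : Equiv.Perm.sign z = Equiv.Perm.sign y := by
      simp [z]
    rw [← this, hsum]

theorem block_lt_of_lt {N p q : ℕ} {y : Equiv.Perm (Fin N)}
    (hy : ∀ i, block p q (y i) = block p q i) (i : Fin N) (hi : (i : ℕ) < p) : (y i : ℕ) < p := by
  have h := hy i
  unfold block at h
  rw [if_pos hi] at h
  by_contra hc
  rw [if_neg hc] at h
  split_ifs at h

theorem eq_of_block_eq_one {N p : ℕ} {y : Equiv.Perm (Fin N)}
    (hy : ∀ i, block p 1 (y i) = block p 1 i) (i : Fin N) (hi : (i : ℕ) = p) : y i = i := by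
  have h := hy i
  have h1 : block p 1 i = 1 := by
    unfold block
    rw [if_neg (by omega), if_pos (by omega)]
  rw [h1] at h
  unfold block at h
  split_ifs at h
  · exact Fin.ext (by omega)
  · omega

theorem cons_apply_eq (T : V →ₗ[K] V) {k : ℕ} (w : Fin (k + 1) → V) :
    (fun i => (Fin.cons T (fun _ => LinearMap.id) : Fin (k + 1) → V →ₗ[K] V) i (w i)) =
      Fin.cons (T (w 0)) fun j => w j.succ := by
  funext i
  refine Fin.cases ?_ (fun j => ?_) i <;> simp

/-- For an alternating map `P`, the linear map sending `x` to the multilinear map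
`w ↦ P(ρ(x) w_0, w_1, …, w_k)`. -/
def actFirst (ρ : L →ₗ[K] V →ₗ[K] V) {k : ℕ} (P : V [⋀^Fin (k + 1)]→ₗ[K] L) :
    L →ₗ[K] MultilinearMap K (fun _ : Fin (k + 1) => V) L where
  toFun x := P.toMultilinearMap.compLinearMap (Fin.cons (ρ x) fun _ => LinearMap.id)
  map_add' x y := by
    ext w
    simp only [MultilinearMap.compLinearMap_apply, _root_.add_apply, cons_apply_eq, map_add]
    exact P.map_vecCons_add _ _ _
  map_smul' c x := by
    ext w
    simp only [MultilinearMap.compLinearMap_apply, _root_.smul_apply, cons_apply_eq, map_smul]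
    exact P.map_vecCons_smul _ _ _

theorem actFirst_apply (ρ : L →ₗ[K] V →ₗ[K] V) {k : ℕ} (P : V [⋀^Fin (k + 1)]→ₗ[K] L) (x : L)
    (w : Fin (k + 1) → V) :
    actFirst ρ P x w = P (Fin.cons (ρ x (w 0)) fun j => w j.succ) :=
  congrArg P (cons_apply_eq (ρ x) w)

/-- The multilinear map `u ↦ B(A(u_0, …, u_{m-1}))(u_m, …, u_{m+n-1})`. -/
def joinMultilinear {m n : ℕ} (A : V [⋀^Fin m]→ₗ[K] L)
    (B : L →ₗ[K] MultilinearMap K (fun _ : Fin n => V) L) :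
    MultilinearMap K (fun _ : Fin (m + n) => V) L :=
  MultilinearMap.domDomCongr finSumFinEquiv
    (MultilinearMap.uncurrySum (N := fun _ : Fin m ⊕ Fin n => V)
      (B.compMultilinearMap A.toMultilinearMap))

theorem joinMultilinear_apply {m n : ℕ} (A : V [⋀^Fin m]→ₗ[K] L)
    (B : L →ₗ[K] MultilinearMap K (fun _ : Fin n => V) L) (u : Fin (m + n) → V) :
    joinMultilinear A B u =
      B (A fun i => u (Fin.castAdd n i)) (fun j => u (Fin.natAdd m j)) := by
  simp [joinMultilinear]

theorem joinMultilinear_perm {m n : ℕ} (A : V [⋀^Fin m]→ₗ[K] L)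
    (B : L →ₗ[K] MultilinearMap K (fun _ : Fin n => V) L) (y : Equiv.Perm (Fin (m + n)))
    (hy : ∀ i : Fin (m + n), (i : ℕ) < m → (y i : ℕ) < m)
    (hB : ∀ (z : Equiv.Perm (Fin n)), (∀ j, y (Fin.natAdd m j) = Fin.natAdd m (z j)) →
      ∀ (x : L) (w : Fin n → V), B x (w ∘ z) = Equiv.Perm.sign z • B x w)
    (u : Fin (m + n) → V) :
    joinMultilinear A B (u ∘ y) = Equiv.Perm.sign y • joinMultilinear A B u := by
  obtain ⟨y₁, y₂, h₁, h₂, hs⟩ := exists_split y hy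
  rw [joinMultilinear_apply, joinMultilinear_apply]
  have e1 : (fun i => (u ∘ y) (Fin.castAdd n i)) = (fun i => u (Fin.castAdd n i)) ∘ y₁ := by
    funext i; simp [h₁]
  have e2 : (fun i => (u ∘ y) (Fin.natAdd m i)) = (fun i => u (Fin.natAdd m i)) ∘ y₂ := by
    funext i; simp [h₂]
  rw [e1, e2, A.map_perm, hB y₂ h₂, hs, mul_comm, mul_smul]
  congr 1
  rcases Int.units_eq_one_or (Equiv.Perm.sign y₁) with h | h <;> simp [h]

theorem actFirst_perm (ρ : L →ₗ[K] V →ₗ[K] V) {k : ℕ} (P : V [⋀^Fin (k + 1)]→ₗ[K] L)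
    (z : Equiv.Perm (Fin (k + 1))) (hz : z 0 = 0) (x : L) (w : Fin (k + 1) → V) :
    actFirst ρ P x (w ∘ z) = Equiv.Perm.sign z • actFirst ρ P x w := by
  rw [actFirst_apply, actFirst_apply, ← P.map_perm]
  congr 1
  funext i
  refine Fin.cases ?_ (fun j => ?_) i
  · simp [hz]
  · have : z j.succ ≠ 0 := fun h => Fin.succ_ne_zero j (z.injective (h.trans hz.symm))
    obtain ⟨l, hl⟩ := Fin.exists_succ_eq.mpr this
    simp [← hl]

/-- For alternating maps `P` in `k + 1` and `Q` in `m` variables, the alternating map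
`u ↦ ∑_{σ ∈ S_(m,1,k)} (-1)^σ P(ρ(Q(u_σ(1), …, u_σ(m))) u_σ(m+1), u_σ(m+2), …, u_σ(m+k+1))`;
see `insertSucc_apply`. -/
def insertSucc (ρ : L →ₗ[K] V →ₗ[K] V) {k m : ℕ} (P : V [⋀^Fin (k + 1)]→ₗ[K] L)
    (Q : V [⋀^Fin m]→ₗ[K] L) : V [⋀^Fin (m + (k + 1))]→ₗ[K] L :=
  shuffleSum m 1 (joinMultilinear Q (actFirst ρ P)) fun y hy u =>
    joinMultilinear_perm Q (actFirst ρ P) y (block_lt_of_lt hy)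
      (fun z hz x w => actFirst_perm ρ P z
        (Fin.natAdd_injective _ m ((hz 0).symm.trans (eq_of_block_eq_one hy _ (by simp)))) x w) u

theorem insertSucc_apply (ρ : L →ₗ[K] V →ₗ[K] V) {k m : ℕ} (P : V [⋀^Fin (k + 1)]→ₗ[K] L)
    (Q : V [⋀^Fin m]→ₗ[K] L) (u : Fin (m + (k + 1)) → V) :
    insertSucc ρ P Q u = ∑ σ ∈ shuffles (m + (k + 1)) m 1, (Equiv.Perm.sign σ : ℤ) •
      P (Fin.cons (ρ (Q fun i => u (σ (Fin.castAdd (k + 1) i))) (u (σ (Fin.natAdd m 0))))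
        fun j : Fin k => u (σ (Fin.natAdd m j.succ))) := by
  rw [insertSucc, shuffleSum_apply]
  simp only [joinMultilinear_apply, actFirst_apply]

/-- For alternating maps `P` in `n` and `Q` in `m` variables, the alternating map
`u ↦ ∑_{σ ∈ S_(m,1,n-1)} (-1)^σ P(ρ(Q(u_σ(1), …, u_σ(m))) u_σ(m+1), u_σ(m+2), …, u_σ(m+n))`.
The sum is empty for `n = 0`. -/
def insertion (ρ : L →ₗ[K] V →ₗ[K] V) : {n m : ℕ} → (V [⋀^Fin n]→ₗ[K] L) →
    (V [⋀^Fin m]→ₗ[K] L) → V [⋀^Fin (m + n)]→ₗ[K] L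
  | 0, _, _, _ => 0
  | _ + 1, _, P, Q => insertSucc ρ P Q

/-- For alternating maps `P` in `n` and `Q` in `m` variables, the alternating map
`u ↦ ∑_{σ ∈ S_(n,m)} (-1)^σ [P(u_σ(1), …, u_σ(n)), Q(u_σ(n+1), …, u_σ(n+m))]`;
see `shuffleLie_apply`. -/
def shuffleLie {n m : ℕ} (P : V [⋀^Fin n]→ₗ[K] L) (Q : V [⋀^Fin m]→ₗ[K] L) :
    V [⋀^Fin (n + m)]→ₗ[K] L :=
  shuffleSum n m
    (joinMultilinear P
      { toFun := fun x => (LinearMap.mk (AddHom.mk (fun z : L => ⁅x, z⁆) (lie_add x))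
          fun c z => lie_smul c x z).compMultilinearMap Q.toMultilinearMap
        map_add' := fun x y => by ext w; exact add_lie x y (Q w)
        map_smul' := fun c x => by ext w; exact smul_lie c x (Q w) })
    fun y hy u => joinMultilinear_perm P _ y (block_lt_of_lt hy) (fun z _ x w => by
      change ⁅x, Q (w ∘ z)⁆ = Equiv.Perm.sign z • ⁅x, Q w⁆
      rw [Q.map_perm]
      rcases Int.units_eq_one_or (Equiv.Perm.sign z) with h | h <;> simp [h]) u

theorem shuffleLie_apply {n m : ℕ} (P : V [⋀^Fin n]→ₗ[K] L) (Q : V [⋀^Fin m]→ₗ[K] L)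
    (u : Fin (n + m) → V) :
    shuffleLie P Q u = ∑ σ ∈ shuffles (n + m) n m, (Equiv.Perm.sign σ : ℤ) •
      ⁅P fun i => u (σ (Fin.castAdd m i)), Q fun j => u (σ (Fin.natAdd n j))⁆ := by
  rw [shuffleLie, shuffleSum_apply]
  simp only [joinMultilinear_apply]
  rfl

/-- The bracket `⟦P, Q⟧` of `P ∈ Hom(⋀ⁿ V, L)` and `Q ∈ Hom(⋀ᵐ V, L)`:
`⟦P, Q⟧ = ∑_{S_(m,1,n-1)} (-1)^σ P(ρ(Q(u_σ(1), …, u_σ(m))) u_σ(m+1), u_σ(m+2), …)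
  - (-1)^(mn) ∑_{S_(n,1,m-1)} (-1)^σ Q(ρ(P(u_σ(1), …, u_σ(n))) u_σ(n+1), u_σ(n+2), …)
  + (-1)^(mn) ∑_{S_(n,m)} (-1)^σ [P(u_σ(1), …, u_σ(n)), Q(u_σ(n+1), …, u_σ(n+m))]`. -/
def homBracket (ρ : L →ₗ[K] V →ₗ[K] V) {n m : ℕ} (P : V [⋀^Fin n]→ₗ[K] L)
    (Q : V [⋀^Fin m]→ₗ[K] L) : V [⋀^Fin (n + m)]→ₗ[K] L :=
  (insertion ρ P Q).domDomCongr (finCongr (Nat.add_comm m n))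
    - (-1 : K) ^ (m * n) • insertion ρ Q P
    + (-1 : K) ^ (m * n) • shuffleLie P Q

end Bracket

section Bilinear

variable {K L V : Type*} [Field K] [CharZero K] [LieRing L] [LieAlgebra K L]
  [AddCommGroup V] [Module K V]

theorem insertion_add_left (ρ : L →ₗ[K] V →ₗ[K] V) {n m : ℕ} (P P' : V [⋀^Fin n]→ₗ[K] L)
    (Q : V [⋀^Fin m]→ₗ[K] L) : insertion ρ (P + P') Q = insertion ρ P Q + insertion ρ P' Q := by
  cases n with
  | zero => simp [insertion]
  | succ k =>
    ext u
    simp only [insertion, insertSucc_apply, AlternatingMap.add_apply, smul_add,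
      Finset.sum_add_distrib]

theorem insertion_smul_left (ρ : L →ₗ[K] V →ₗ[K] V) {n m : ℕ} (c : K) (P : V [⋀^Fin n]→ₗ[K] L)
    (Q : V [⋀^Fin m]→ₗ[K] L) : insertion ρ (c • P) Q = c • insertion ρ P Q := by
  cases n with
  | zero => simp [insertion]
  | succ k =>
    ext u
    simp only [insertion, insertSucc_apply, AlternatingMap.smul_apply, Finset.smul_sum,
      smul_comm c]

theorem insertion_add_right (ρ : L →ₗ[K] V →ₗ[K] V) {n m : ℕ} (P : V [⋀^Fin n]→ₗ[K] L)
    (Q Q' : V [⋀^Fin m]→ₗ[K] L) : insertion ρ P (Q + Q') = insertion ρ P Q + insertion ρ P Q' := by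
  cases n with
  | zero => simp [insertion]
  | succ k =>
    ext u
    simp only [insertion, insertSucc_apply, AlternatingMap.add_apply, ← Finset.sum_add_distrib,
      map_add, LinearMap.add_apply, ← smul_add]
    refine Finset.sum_congr rfl fun σ _ => congrArg _ ?_
    exact P.map_vecCons_add _ _ _

theorem insertion_smul_right (ρ : L →ₗ[K] V →ₗ[K] V) {n m : ℕ} (c : K) (P : V [⋀^Fin n]→ₗ[K] L)
    (Q : V [⋀^Fin m]→ₗ[K] L) : insertion ρ P (c • Q) = c • insertion ρ P Q := by
  cases n with
  | zero => simp [insertion]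
  | succ k =>
    ext u
    simp only [insertion, insertSucc_apply, AlternatingMap.smul_apply, Finset.smul_sum,
      map_smul, LinearMap.smul_apply, smul_comm c]
    refine Finset.sum_congr rfl fun σ _ => congrArg _ ?_
    exact P.map_vecCons_smul _ _ _

/-- `homBracket` as a bilinear map. -/
def homBracketₗ (ρ : L →ₗ[K] V →ₗ[K] V) (n m : ℕ) :
    (V [⋀^Fin n]→ₗ[K] L) →ₗ[K] (V [⋀^Fin m]→ₗ[K] L) →ₗ[K] V [⋀^Fin (n + m)]→ₗ[K] L :=
  LinearMap.mk₂ K (homBracket ρ)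
    (fun P P' Q => by
      ext u
      simp only [homBracket, insertion_add_left, insertion_add_right, AlternatingMap.add_apply,
        AlternatingMap.sub_apply, AlternatingMap.smul_apply, AlternatingMap.domDomCongr_apply,
        shuffleLie_apply, add_lie, smul_add, Finset.sum_add_distrib]
      abel)
    (fun c P Q => by
      ext u
      simp only [homBracket, insertion_smul_left, insertion_smul_right, AlternatingMap.add_apply,
        AlternatingMap.sub_apply, AlternatingMap.smul_apply, AlternatingMap.domDomCongr_apply,
        shuffleLie_apply, smul_lie, smul_add, smul_sub, Finset.smul_sum, smul_comm c])
    (fun P Q Q' => by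
      ext u
      simp only [homBracket, insertion_add_left, insertion_add_right, AlternatingMap.add_apply,
        AlternatingMap.sub_apply, AlternatingMap.smul_apply, AlternatingMap.domDomCongr_apply,
        shuffleLie_apply, lie_add, smul_add, Finset.sum_add_distrib]
      abel)
    (fun c P Q => by
      ext u
      simp only [homBracket, insertion_smul_left, insertion_smul_right, AlternatingMap.add_apply,
        AlternatingMap.sub_apply, AlternatingMap.smul_apply, AlternatingMap.domDomCongr_apply,
        shuffleLie_apply, lie_smul, smul_add, smul_sub, Finset.smul_sum, smul_comm c])

end Bilinear

/-! ### Graded Lie brackets and Maurer–Cartan elements -/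

section Graded

variable {K : Type*} [Field K] {C : ℕ → Type*} [∀ k, AddCommMonoid (C k)] [∀ k, Module K (C k)]

/-- The bilinear map on `⨁ₖ C k` with homogeneous components `b i j : C i × C j → C (i + j)`. -/
noncomputable def totalBracket (b : ∀ i j, C i →ₗ[K] C j →ₗ[K] C (i + j)) :
    (⨁ k, C k) →ₗ[K] (⨁ k, C k) →ₗ[K] ⨁ k, C k :=
  DirectSum.toModule K ℕ _ fun i => LinearMap.flip <|
    DirectSum.toModule K ℕ _ fun j => LinearMap.flip <|
      (b i j).compr₂ (DirectSum.lof K ℕ C (i + j))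

theorem totalBracket_lof (b : ∀ i j, C i →ₗ[K] C j →ₗ[K] C (i + j)) (i j : ℕ) (x : C i)
    (y : C j) : totalBracket b (DirectSum.lof K ℕ C i x) (DirectSum.lof K ℕ C j y) =
      DirectSum.lof K ℕ C (i + j) (b i j x y) := by
  simp [totalBracket]

/-- `⨁ₖ C k`, with `C k` in degree `k`, is a graded Lie algebra under the bilinear operation `br`. -/
structure IsGradedLieBracket (br : (⨁ k, C k) →ₗ[K] (⨁ k, C k) →ₗ[K] ⨁ k, C k) : Prop where
  /-- The bracket has degree zero. -/
  degree : ∀ (i j : ℕ) (x : C i) (y : C j), ∃ z : C (i + j),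
    br (DirectSum.lof K ℕ C i x) (DirectSum.lof K ℕ C j y) = DirectSum.lof K ℕ C (i + j) z
  /-- Graded skew-symmetry: `[x, y] = -(-1)^(|x||y|) [y, x]`. -/
  skew : ∀ (i j : ℕ) (x : C i) (y : C j),
    br (DirectSum.lof K ℕ C i x) (DirectSum.lof K ℕ C j y) =
      (-(-1 : K) ^ (i * j)) • br (DirectSum.lof K ℕ C j y) (DirectSum.lof K ℕ C i x)
  /-- Graded Jacobi identity: `[x, [y, z]] = [[x, y], z] + (-1)^(|x||y|) [y, [x, z]]`. -/
  jacobi : ∀ (i j k : ℕ) (x : C i) (y : C j) (z : C k),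
    br (DirectSum.lof K ℕ C i x) (br (DirectSum.lof K ℕ C j y) (DirectSum.lof K ℕ C k z)) =
      br (br (DirectSum.lof K ℕ C i x) (DirectSum.lof K ℕ C j y)) (DirectSum.lof K ℕ C k z) +
      (-1 : K) ^ (i * j) •
        br (DirectSum.lof K ℕ C j y) (br (DirectSum.lof K ℕ C i x) (DirectSum.lof K ℕ C k z))

/-- An element `θ` of degree one is a Maurer–Cartan element (for the zero differential) if
`½ [θ, θ] = 0`. -/
def IsMaurerCartan (br : (⨁ k, C k) →ₗ[K] (⨁ k, C k) →ₗ[K] ⨁ k, C k) (θ : C 1) : Prop :=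
  (1 / 2 : K) • br (DirectSum.lof K ℕ C 1 θ) (DirectSum.lof K ℕ C 1 θ) = 0

end Graded

/-! ### The isomorphism `⋀ᵏ g ⊗ g ≃ Hom(⋀ᵏ g*, g)` -/

section Psi

open Module

variable (K g : Type*) [Field K] [AddCommGroup g] [Module K g]

/-- The degree `k` component `⋀ᵏ g ⊗ g` of the graded vector space `⨁ₖ ⋀ᵏ g ⊗ g`. -/
abbrev Cochain (k : ℕ) : Type _ := (⋀[K]^k g) ⊗[K] g

variable {K g}

/-- The pairing `⟨φ, α_1 ∧ ⋯ ∧ α_k ⊗ β⟩` of `φ ∈ ⋀ᵏ g ⊗ g` with linear forms, where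
`⟨x_1 ∧ ⋯ ∧ x_k, α_1 ∧ ⋯ ∧ α_k⟩ = det (α_j(x_i))`. -/
noncomputable def Cochain.eval {k : ℕ} (φ : Cochain K g k) (α : Fin k → Dual K g) (β : Dual K g) :
    K :=
  TensorProduct.dualDistrib K (⋀[K]^k g) g
    (exteriorPower.pairingDual K g k (exteriorPower.ιMulti K k α) ⊗ₜ[K] β) φ

/-- The linear map `Ψ : ⋀ᵏ g ⊗ g → Hom(⋀ᵏ g*, g)`,
`Ψ(ω ⊗ x)(α_1, …, α_k) = ⟨ω, α_1 ∧ ⋯ ∧ α_k⟩ x`. -/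
noncomputable def psiLinear (k : ℕ) : Cochain K g k →ₗ[K] (Dual K g) [⋀^Fin k]→ₗ[K] g :=
  (exteriorPower.alternatingMapLinearEquiv (R := K) (M := Dual K g) (N := g)
      (n := k)).symm.toLinearMap ∘ₗ
    dualTensorHom K (⋀[K]^k (Dual K g)) g ∘ₗ
      LinearMap.rTensor g (exteriorPower.pairingDual K g k).flip

theorem psiLinear_tmul (k : ℕ) (ω : ⋀[K]^k g) (x : g) (α : Fin k → Dual K g) :
    psiLinear k (ω ⊗ₜ[K] x) α =
      exteriorPower.pairingDual K g k (exteriorPower.ιMulti K k α) ω • x := by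
  simp [psiLinear]

/-- The defining property `⟨Ψ(φ)(α_1, …, α_k), β⟩ = ⟨φ, α_1 ∧ ⋯ ∧ α_k ⊗ β⟩`. -/
theorem apply_psiLinear (k : ℕ) (φ : Cochain K g k) (α : Fin k → Dual K g) (β : Dual K g) :
    β (psiLinear k φ α) = φ.eval α β := by
  induction φ using TensorProduct.induction_on with
  | zero => simp [Cochain.eval]
  | tmul ω x => simp [psiLinear_tmul, Cochain.eval]
  | add a b ha hb =>
    simp only [Cochain.eval] at ha hb ⊢
    simp [ha, hb]

theorem pairing_flip_bijective [FiniteDimensional K g] (k : ℕ) :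
    Function.Bijective (exteriorPower.pairingDual K g k).flip := by
  have hinj : Function.Injective (exteriorPower.pairingDual K g k).flip := by
    rw [injective_iff_map_eq_zero]
    intro ω hω
    let b := Module.finBasis K g
    apply (b.exteriorPower k).repr.injective
    ext s
    rw [exteriorPower.basis_repr_apply, map_zero]
    exact LinearMap.congr_fun hω (exteriorPower.ιMulti_family K k b.coord s)
  refine ⟨hinj, ?_⟩
  refine (LinearMap.injective_iff_surjective_of_finrank_eq_finrank ?_).mp hinj
  rw [Subspace.dual_finrank_eq, exteriorPower.finrank_eq, exteriorPower.finrank_eq,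
    Subspace.dual_finrank_eq]

theorem psiLinear_bijective [FiniteDimensional K g] (k : ℕ) :
    Function.Bijective (psiLinear (K := K) (g := g) k) := by
  let e := LinearEquiv.ofBijective _ (pairing_flip_bijective (K := K) (g := g) k)
  have : psiLinear (K := K) (g := g) k =
      ((TensorProduct.congr e (LinearEquiv.refl K g)) ≪≫ₗ
        (dualTensorHomEquiv K (⋀[K]^k (Dual K g)) g) ≪≫ₗ
        (exteriorPower.alternatingMapLinearEquiv (R := K) (M := Dual K g) (N := g)
          (n := k)).symm).toLinearMap := by
    ext ω x α
    simp [psiLinear, e]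
  rw [this]
  exact LinearEquiv.bijective _

/-- The isomorphism `Ψ : ⋀ᵏ g ⊗ g ≃ Hom(⋀ᵏ g*, g)`. -/
noncomputable def psi [FiniteDimensional K g] (k : ℕ) :
    Cochain K g k ≃ₗ[K] (Dual K g) [⋀^Fin k]→ₗ[K] g :=
  LinearEquiv.ofBijective (psiLinear k) (psiLinear_bijective k)

/-- The inverse `Υ : Hom(⋀ᵏ g*, g) ≃ ⋀ᵏ g ⊗ g` of `Ψ`. -/
noncomputable def upsilon [FiniteDimensional K g] (k : ℕ) :
    ((Dual K g) [⋀^Fin k]→ₗ[K] g) ≃ₗ[K] Cochain K g k :=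
  (psi k).symm

/-- The defining property `⟨Υ(P), α_1 ∧ ⋯ ∧ α_k ⊗ β⟩ = ⟨P(α_1, …, α_k), β⟩`. -/
theorem eval_upsilon [FiniteDimensional K g] (k : ℕ) (P : (Dual K g) [⋀^Fin k]→ₗ[K] g)
    (α : Fin k → Dual K g) (β : Dual K g) : (upsilon k P).eval α β = β (P α) := by
  rw [← apply_psiLinear]
  exact congrArg (fun Q : (Dual K g) [⋀^Fin k]→ₗ[K] g => β (Q α)) ((psi k).apply_symm_apply P)

end Psi

/-! ### Pre-Lie algebras, `s`-matrices and the bracket on `⨁ₖ ⋀ᵏ g ⊗ g` -/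

section PreLie

open Module

variable {K g : Type*} [Field K] [LeftPreLieRing g] [LeftPreLieAlgebra K g]

/-- The map `L^* : g → gl(g*)`, `⟨L^*_x α, y⟩ = -⟨α, x · y⟩`. -/
def lStar (K g : Type*) [Field K] [LeftPreLieRing g] [LeftPreLieAlgebra K g] :
    g →ₗ[K] Dual K g →ₗ[K] Dual K g :=
  LinearMap.mk₂ K (fun x α => -(α ∘ₗ LinearMap.mulLeft K x))
    (fun x y α => by ext z; simp [add_mul, add_comm])
    (fun c x α => by ext z; simp [smul_mul_assoc])
    (fun x α β => by ext z; simp [add_comm])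
    (fun c x α => by ext z; simp)

theorem lStar_apply (x y : g) (α : Dual K g) : lStar K g x α y = -α (x * y) := rfl

/-- `L^*` is a representation of the sub-adjacent Lie algebra, whose bracket is
`⁅x, y⁆ = x · y - y · x`. -/
theorem lStar_lie (x y : g) (α : Dual K g) :
    lStar K g ⁅x, y⁆ α = lStar K g x (lStar K g y α) - lStar K g y (lStar K g x α) := by
  ext z
  have h := LeftPreLieRing.assoc_symm x y z
  simp only [associator_apply] at h
  simp only [lStar_apply, LinearMap.sub_apply, Ring.lie_def, map_sub, neg_neg]
  have h' : x * y * z - y * x * z = x * (y * z) - y * (x * z) := by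
    grind
  have := congrArg α h'
  simp only [map_sub] at this
  linear_combination -this

/-- The bracket `⟦φ, ϕ⟧_s = Υ⟦Ψ(φ), Ψ(ϕ)⟧ : (⋀ᵏ g ⊗ g) × (⋀ˡ g ⊗ g) → ⋀ᵏ⁺ˡ g ⊗ g`, where `⟦-, -⟧` is
the bracket on `⨁ₖ Hom(⋀ᵏ g*, g)` for the representation `L^*` of the sub-adjacent Lie algebra. -/
noncomputable def sBracket (K g : Type*) [Field K] [CharZero K] [LeftPreLieRing g]
    [LeftPreLieAlgebra K g] [FiniteDimensional K g] (k l : ℕ) :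
    Cochain K g k →ₗ[K] Cochain K g l →ₗ[K] Cochain K g (k + l) :=
  ((homBracketₗ (lStar K g) k l).compl₁₂ (psi k).toLinearMap (psi l).toLinearMap).compr₂
    (upsilon (k + l)).toLinearMap

theorem sBracket_apply [CharZero K] [FiniteDimensional K g] (k l : ℕ) (φ : Cochain K g k)
    (ϕ : Cochain K g l) :
    sBracket K g k l φ ϕ = upsilon (k + l) (homBracket (lStar K g) (psi k φ) (psi l ϕ)) := rfl

/-- The bracket `⟦-, -⟧_s` on the graded vector space `⨁ₖ ⋀ᵏ g ⊗ g`, with `⋀ᵏ g ⊗ g` in degree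
`k`. -/
noncomputable def sBracketTotal (K g : Type*) [Field K] [CharZero K] [LeftPreLieRing g]
    [LeftPreLieAlgebra K g] [FiniteDimensional K g] :
    (⨁ k, Cochain K g k) →ₗ[K] (⨁ k, Cochain K g k) →ₗ[K] ⨁ k, Cochain K g k :=
  totalBracket (sBracket K g)

/-- `r₁₂ · r'₁₃ = ∑ a · c ⊗ b ⊗ d` for `r = ∑ a ⊗ b` and `r' = ∑ c ⊗ d`. -/
noncomputable def mul12_13 : (g ⊗[K] g) ⊗[K] (g ⊗[K] g) →ₗ[K] g ⊗[K] (g ⊗[K] g) :=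
  LinearMap.rTensor (g ⊗[K] g) (LinearMap.mul' K g) ∘ₗ
    (TensorProduct.tensorTensorTensorComm K g g g g).toLinearMap

theorem mul12_13_tmul (a b c d : g) :
    mul12_13 ((a ⊗ₜ[K] b) ⊗ₜ[K] (c ⊗ₜ[K] d)) = (a * c) ⊗ₜ[K] (b ⊗ₜ[K] d) := by
  simp [mul12_13]

/-- `r₁₂ · r'₂₃ = ∑ a ⊗ b · c ⊗ d` for `r = ∑ a ⊗ b` and `r' = ∑ c ⊗ d`. -/
noncomputable def mul12_23 : (g ⊗[K] g) ⊗[K] (g ⊗[K] g) →ₗ[K] g ⊗[K] (g ⊗[K] g) :=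
  LinearMap.lTensor g (LinearMap.rTensor g (LinearMap.mul' K g) ∘ₗ
      (TensorProduct.assoc K g g g).symm.toLinearMap) ∘ₗ
    (TensorProduct.assoc K g g (g ⊗[K] g)).toLinearMap

theorem mul12_23_tmul (a b c d : g) :
    mul12_23 ((a ⊗ₜ[K] b) ⊗ₜ[K] (c ⊗ₜ[K] d)) = a ⊗ₜ[K] ((b * c) ⊗ₜ[K] d) := by
  simp [mul12_23]

/-- `[r₁₃, r'₂₃] = ∑ a ⊗ c ⊗ [b, d]` for `r = ∑ a ⊗ b` and `r' = ∑ c ⊗ d`. -/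
noncomputable def lie13_23 : (g ⊗[K] g) ⊗[K] (g ⊗[K] g) →ₗ[K] g ⊗[K] (g ⊗[K] g) :=
  (TensorProduct.assoc K g g g).toLinearMap ∘ₗ
    LinearMap.lTensor (g ⊗[K] g)
      (LinearMap.mul' K g - LinearMap.mul' K g ∘ₗ (TensorProduct.comm K g g).toLinearMap) ∘ₗ
    (TensorProduct.tensorTensorTensorComm K g g g g).toLinearMap

theorem lie13_23_tmul (a b c d : g) :
    lie13_23 ((a ⊗ₜ[K] b) ⊗ₜ[K] (c ⊗ₜ[K] d)) = a ⊗ₜ[K] (c ⊗ₜ[K] ⁅b, d⁆) := by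
  simp [lie13_23, Ring.lie_def, TensorProduct.tmul_sub]

/-- `[r, r] = -r₁₂ · r₁₃ + r₁₂ · r₂₃ + [r₁₃, r₂₃]`. -/
noncomputable def sTensor (r : g ⊗[K] g) : g ⊗[K] (g ⊗[K] g) :=
  -mul12_13 (r ⊗ₜ[K] r) + mul12_23 (r ⊗ₜ[K] r) + lie13_23 (r ⊗ₜ[K] r)

/-- The value `t(α₁, α₂, α₃)` of `t ∈ g ⊗ g ⊗ g`. -/
noncomputable def evalTriple (t : g ⊗[K] (g ⊗[K] g)) (α₁ α₂ α₃ : Dual K g) : K :=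
  TensorProduct.dualDistrib K g (g ⊗[K] g)
    (α₁ ⊗ₜ[K] TensorProduct.dualDistrib K g g (α₂ ⊗ₜ[K] α₃)) t

/-- `r ∈ Sym²(g)`. -/
def IsSymmTensor (r : g ⊗[K] g) : Prop := TensorProduct.comm K g g r = r

/-- An `s`-matrix is a symmetric tensor `r` with `[r, r] = 0`. -/
def IsSMatrix (r : g ⊗[K] g) : Prop := IsSymmTensor r ∧ sTensor r = 0

/-- A tensor `r ∈ g ⊗ g` as an element of `⋀¹ g ⊗ g`. -/
noncomputable def toCochain (r : g ⊗[K] g) : Cochain K g 1 :=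
  LinearMap.rTensor g (exteriorPower.oneEquiv K g).symm.toLinearMap r

end PreLie

end SMatrix

/-! The bracket is easier to recognise on tensors than on alternating maps. The exterior algebra `Λ
= ExteriorAlgebra K g` is graded commutative. Each `x` in `g` acts on it by the degree-zero
derivation `a ↦ x · a` extending left multiplication by `x`, and the pre-Lie identity says exactly
that this is an action of the sub-adjacent Lie algebra. Hence `Λ ⊗ g` carries the bracket of an
action Lie algebroid, `[a ⊗ x, b ⊗ y] = ab ⊗ [x, y] + a (x · b) ⊗ y - (y · a) b ⊗ x`. Its
skew-symmetry follows from graded commutativity; its Jacobi identity also uses the Leibniz rule, the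
action property and the Jacobi identity of `g` (`extBracket_skew`, `extBracket_jacobi`).

The bracket of the theorem is `(-1)^(kl)` times this one in degrees `k`, `l` (`toExt_sBracket`). The
twist is harmless: both nested brackets of elements of degrees `i, j, k` acquire the sign `(-1)^(ij
+ jk + ik)`, symmetric in the degrees. The comparison is made on decomposable tensors. There the
alternating maps are determinants, and the shuffle sums are Laplace expansions
(`sum_shuffles_pairing`, `sum_shuffles_pairing_cons`). These are proved by passing to sums over all
permutations and cancelling the order of the block stabiliser, which is nonzero in characteristic
zero.

For the second part, the degree-one bracket is computed on `a ⊗ b` and `c ⊗ d` and extended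
bilinearly (`eval_sBracket_toCochain`). The outcome differs from the polarisation of `-2 [r, r]`
only by a flip of one leg in the term `r₁₂ · r₁₃`, and the flip disappears for symmetric `r`. -/

namespace SMatrix

/-! ### Counting permutations that preserve blocks -/

section Permutations

/-- The permutations of `{0, …, m + n - 1}` preserving the blocks of lengths `m`, `q`, `n - q`
are the pairs of a permutation of the first block and one preserving the other two. -/
theorem card_block_preserving (m n q : ℕ) :
    (Finset.univ.filter fun y : Equiv.Perm (Fin (m + n)) =>
      ∀ i, block m q (y i) = block m q i).card =
    Fintype.card (Equiv.Perm (Fin m)) * (Finset.univ.filter fun z : Equiv.Perm (Fin n) =>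
      ∀ i, block 0 q (z i) = block 0 q i).card := by
  rw [Fintype.card, ← Finset.card_product]
  have hl : ∀ i : Fin m, block m q (Fin.castAdd n i) = 0 := fun i => by simp [block]
  have hr : ∀ i : Fin n, block m q (Fin.natAdd m i) = block 0 q i := fun i => by simp [block]
  have apply_left : ∀ (w : Equiv.Perm (Fin m) × Equiv.Perm (Fin n)) i,
      finSumFinEquiv.permCongr (Equiv.sumCongr w.1 w.2) (Fin.castAdd n i) =
        Fin.castAdd n (w.1 i) := fun w i => by simp [Equiv.permCongr_apply]
  have apply_right : ∀ (w : Equiv.Perm (Fin m) × Equiv.Perm (Fin n)) i,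
      finSumFinEquiv.permCongr (Equiv.sumCongr w.1 w.2) (Fin.natAdd m i) =
        Fin.natAdd m (w.2 i) := fun w i => by simp [Equiv.permCongr_apply]
  symm
  refine Finset.card_bij
    (fun w _ => finSumFinEquiv.permCongr (Equiv.sumCongr w.1 w.2)) ?_ ?_ ?_
  · intro w hw
    simp only [Finset.mem_product, Finset.mem_filter, Finset.mem_univ, true_and] at hw ⊢
    intro i
    refine Fin.addCases (fun i => ?_) (fun i => ?_) i
    · rw [apply_left, hl, hl]
    · rw [apply_right, hr, hr, hw]
  · intro w _ w' _ h
    ext i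
    · have := congrArg (fun e => e (Fin.castAdd n i)) h
      simp only [apply_left] at this
      simpa using congrArg Fin.val this
    · have := congrArg (fun e => e (Fin.natAdd m i)) h
      simp only [apply_right] at this
      simpa using congrArg Fin.val this
  · intro y hy
    simp only [Finset.mem_filter, Finset.mem_univ, true_and] at hy
    obtain ⟨y₁, y₂, h₁, h₂, -⟩ := exists_split y (block_lt_of_lt hy)
    refine ⟨(y₁, y₂), ?_, ?_⟩
    · simp only [Finset.mem_product, Finset.mem_filter, Finset.mem_univ, true_and]
      intro i
      rw [← hr, ← hr, ← h₂, hy]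
    · refine Equiv.ext fun i => ?_
      refine Fin.addCases (fun i => ?_) (fun i => ?_) i
      · rw [apply_left, h₁]
      · rw [apply_right, h₂]

/-- Summing a function of the position `z⁻¹ 0` over all permutations. -/
theorem sum_perm_symm_zero {k : ℕ} {M : Type*} [AddCommMonoid M] (f : Fin (k + 1) → M) :
    ∑ z : Equiv.Perm (Fin (k + 1)), f (z.symm 0) =
      (Finset.univ.filter fun z : Equiv.Perm (Fin (k + 1)) =>
        ∀ i, block 0 1 (z i) = block 0 1 i).card • ∑ j, f j := by
  -- The first block is empty and the second is `{0}`, so preserving the blocks means fixing `0`.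
  have hz : ∀ z : Equiv.Perm (Fin (k + 1)), (∀ i, block 0 1 (z i) = block 0 1 i) ↔ z 0 = 0 := by
    intro z
    refine ⟨fun h => eq_of_block_eq_one h 0 rfl, fun h i => ?_⟩
    have : z i = 0 ↔ i = 0 := ⟨fun hi => z.injective (hi.trans h.symm), fun hi => hi ▸ h⟩
    simp only [Fin.ext_iff, Fin.val_zero] at this
    simp only [block, not_lt_zero, if_false, zero_add, Nat.lt_one_iff, this]
  simp only [hz]
  rw [← Finset.sum_fiberwise_of_maps_to (g := fun z : Equiv.Perm (Fin (k + 1)) => z.symm 0)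
    (fun _ _ => Finset.mem_univ _), Finset.smul_sum]
  refine Finset.sum_congr rfl fun j _ => ?_
  rw [Finset.sum_congr rfl (g := fun _ => f j) fun z hzj => by
    rw [(Finset.mem_filter.mp hzj).2], Finset.sum_const]
  congr 1
  -- If `z j = 0`, then `z * swap 0 j` fixes `0`; every fibre is thus a coset of the stabiliser of
  -- `0`.
  refine Finset.card_bij (fun z _ => z * Equiv.swap 0 j) ?_ ?_ ?_
  · intro z h
    simp only [Finset.mem_filter, Finset.mem_univ, true_and] at h ⊢
    rw [Equiv.symm_apply_eq] at h
    simp [← h]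
  · intro z _ z' _ h
    exact mul_right_cancel h
  · intro z h
    simp only [Finset.mem_filter, Finset.mem_univ, true_and] at h
    refine ⟨z * Equiv.swap 0 j, ?_, by simp [mul_assoc]⟩
    simp only [Finset.mem_filter, Finset.mem_univ, true_and]
    rw [Equiv.symm_apply_eq]
    simp [h]

end Permutations

/-! ### Determinant pairings as sums over all permutations -/

section Pairing

open Module

variable {K g : Type*} [Field K] [AddCommGroup g] [Module K g]

/-- `⟨x_1 ∧ ⋯ ∧ x_N, u_1 ∧ ⋯ ∧ u_N⟩ = ∑ (-1)^τ ∏ u_τ(i)(x_i)`. -/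
theorem pairingDual_ιMulti_eq_sum {N : ℕ} (u : Fin N → Dual K g) (x : Fin N → g) :
    exteriorPower.pairingDual K g N (exteriorPower.ιMulti K N u) (exteriorPower.ιMulti K N x) =
      ∑ τ : Equiv.Perm (Fin N), ((Equiv.Perm.sign τ : ℤ) : K) * ∏ i, u (τ i) (x i) := by
  rw [exteriorPower.pairingDual_ιMulti_ιMulti, ← Matrix.det_transpose, Matrix.det_apply']
  rfl

/-- The alternating sum over all permutations of a product of two linear combinations of
evaluation products. -/
theorem sum_perm_eq_sum_pairing {m n : ℕ} (F : (Fin (m + n) → Dual K g) → K)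
    (x : Fin m → g) (y : Equiv.Perm (Fin n) → Fin n → g)
    (hF : ∀ u, F u = (∑ s : Equiv.Perm (Fin m), ((Equiv.Perm.sign s : ℤ) : K) *
        ∏ i, u (Fin.castAdd n (s i)) (x i)) *
      ∑ z : Equiv.Perm (Fin n), ((Equiv.Perm.sign z : ℤ) : K) *
        ∏ j, u (Fin.natAdd m (z j)) (y z j)) (u : Fin (m + n) → Dual K g) :
    ∑ τ : Equiv.Perm (Fin (m + n)), ((Equiv.Perm.sign τ : ℤ) : K) * F (u ∘ τ) =
      Fintype.card (Equiv.Perm (Fin m)) • ∑ z : Equiv.Perm (Fin n),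
        exteriorPower.pairingDual K g (m + n) (exteriorPower.ιMulti K _ u)
          (exteriorPower.ιMulti K _ (Fin.append x (y z))) := by
  have key : ∀ (s : Equiv.Perm (Fin m)) (z : Equiv.Perm (Fin n)),
      ∑ τ : Equiv.Perm (Fin (m + n)), ((Equiv.Perm.sign τ : ℤ) : K) *
        ((((Equiv.Perm.sign s : ℤ) : K) * ∏ i, (u ∘ τ) (Fin.castAdd n (s i)) (x i)) *
          (((Equiv.Perm.sign z : ℤ) : K) * ∏ j, (u ∘ τ) (Fin.natAdd m (z j)) (y z j))) =
      exteriorPower.pairingDual K g (m + n) (exteriorPower.ιMulti K _ u)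
          (exteriorPower.ιMulti K _ (Fin.append x (y z))) := by
    intro s z
    rw [pairingDual_ιMulti_eq_sum]
    -- The substitution `τ ↦ τ (s ⊕ z)` absorbs both inner permutations, and their signs combine
    -- with that of `τ`.
    refine Fintype.sum_equiv
      (Equiv.mulRight (finSumFinEquiv.permCongr (Equiv.sumCongr s z))) _ _ fun τ => ?_
    have hs : Equiv.Perm.sign (finSumFinEquiv.permCongr (Equiv.sumCongr s z)) =
        Equiv.Perm.sign s * Equiv.Perm.sign z := by simp
    rw [Equiv.coe_mulRight, Equiv.Perm.sign_mul, hs, Fin.prod_univ_add]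
    simp only [Equiv.Perm.mul_apply, Equiv.permCongr_apply, finSumFinEquiv_symm_apply_castAdd,
      finSumFinEquiv_symm_apply_natAdd, Equiv.sumCongr_apply, Sum.map_inl, Sum.map_inr,
      finSumFinEquiv_apply_left, finSumFinEquiv_apply_right, Fin.append_left, Fin.append_right,
      Function.comp]
    push_cast
    ring
  simp only [hF, Finset.sum_mul_sum]
  simp only [Finset.mul_sum]
  rw [Finset.sum_comm]
  rw [Finset.sum_congr rfl (g := fun _ => ∑ z : Equiv.Perm (Fin n),
        exteriorPower.pairingDual K g (m + n) (exteriorPower.ιMulti K _ u)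
          (exteriorPower.ιMulti K _ (Fin.append x (y z)))), Finset.sum_const, Fintype.card]
  intro s _
  rw [Finset.sum_comm]
  exact Finset.sum_congr rfl fun z _ => key s z

/-- An alternating sum over shuffles equals the alternating sum over all permutations divided by
the number of permutations preserving the blocks. -/
theorem card_smul_sum_shuffles {N : ℕ} (p q : ℕ) {V : Type*} (F : (Fin N → V) → K)
    (hF : ∀ y : Equiv.Perm (Fin N), (∀ i, block p q (y i) = block p q i) →
      ∀ u, F (u ∘ y) = ((Equiv.Perm.sign y : ℤ) : K) * F u) (u : Fin N → V) :
    (Finset.univ.filter fun y : Equiv.Perm (Fin N) => ∀ i, block p q (y i) = block p q i).card •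
      ∑ σ ∈ shuffles N p q, ((Equiv.Perm.sign σ : ℤ) : K) * F (u ∘ σ) =
    ∑ τ : Equiv.Perm (Fin N), ((Equiv.Perm.sign τ : ℤ) : K) * F (u ∘ τ) := by
  refine (sum_perm_eq_card_nsmul p q _ fun σ y hy => ?_).symm
  rw [Equiv.Perm.coe_mul, ← Function.comp_assoc, hF y hy, Equiv.Perm.sign_mul]
  have : ((Equiv.Perm.sign y : ℤ) : K) * ((Equiv.Perm.sign y : ℤ) : K) = 1 := by
    rw [← Int.cast_mul, Int.units_coe_mul_self, Int.cast_one]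
  push_cast
  linear_combination ((Equiv.Perm.sign σ : ℤ) : K) * F (u ∘ σ) * this

end Pairing
-- Laplace expansion over shuffles
section Wedge

open Module

variable {K g : Type*} [Field K] [AddCommGroup g] [Module K g]

/-- After multiplication by `m!` both sides are the alternating sum over all permutations, since the
block stabiliser has order `m!` times the cardinality on the left. The vectors `y z` may depend on
`z` so that the insertion is covered: there the modified entry is the one paired with the first
form, and its index varies with `z`. -/
theorem card_smul_sum_shuffles_pairing [CharZero K] {m n : ℕ} (q : ℕ) (x : Fin m → g)
    (y : Equiv.Perm (Fin n) → Fin n → g) (C : (Fin n → Dual K g) → K)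
    (hC : ∀ w, C w = ∑ z : Equiv.Perm (Fin n), ((Equiv.Perm.sign z : ℤ) : K) *
      ∏ j, w (z j) (y z j))
    (hperm : ∀ z : Equiv.Perm (Fin n), (∀ i, block 0 q (z i) = block 0 q i) →
      ∀ w, C (w ∘ z) = ((Equiv.Perm.sign z : ℤ) : K) * C w) (u : Fin (m + n) → Dual K g) :
    (Finset.univ.filter fun z : Equiv.Perm (Fin n) => ∀ i, block 0 q (z i) = block 0 q i).card •
      ∑ σ ∈ shuffles (m + n) m q, ((Equiv.Perm.sign σ : ℤ) : K) *
        (exteriorPower.pairingDual K g m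
          (exteriorPower.ιMulti K m fun i => u (σ (Fin.castAdd n i))) (exteriorPower.ιMulti K m x) *
          C fun j => u (σ (Fin.natAdd m j))) =
      ∑ z : Equiv.Perm (Fin n), exteriorPower.pairingDual K g (m + n) (exteriorPower.ιMulti K _ u)
        (exteriorPower.ιMulti K _ (Fin.append x (y z))) := by
  let F : (Fin (m + n) → Dual K g) → K := fun u => exteriorPower.pairingDual K g m
    (exteriorPower.ιMulti K m fun i => u (Fin.castAdd n i)) (exteriorPower.ιMulti K m x) *
      C fun j => u (Fin.natAdd m j)
  have hF := sum_perm_eq_sum_pairing F x y (fun u => by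
    simp only [F, pairingDual_ιMulti_eq_sum, hC]) u
  rw [← card_smul_sum_shuffles m q F ?_ u, card_block_preserving, mul_smul] at hF
  · simp only [nsmul_eq_mul] at hF ⊢
    exact mul_left_cancel₀ (Nat.cast_ne_zero.mpr Fintype.card_ne_zero) hF
  · intro y hy u
    obtain ⟨y₁, y₂, h₁, h₂, hs⟩ := exists_split y (block_lt_of_lt hy)
    have hz : ∀ i, block 0 q (y₂ i) = block 0 q i := fun i => by
      have := hy (Fin.natAdd m i)
      rw [h₂] at this
      simpa [block] using this
    have e₁ : (fun i => (u ∘ y) (Fin.castAdd n i)) = (fun i => u (Fin.castAdd n i)) ∘ y₁ := by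
      funext i; simp [h₁]
    have e₂ : (fun i => (u ∘ y) (Fin.natAdd m i)) = (fun i => u (Fin.natAdd m i)) ∘ y₂ := by
      funext i; simp [h₂]
    simp only [F]
    rw [e₁, e₂, hperm y₂ hz, AlternatingMap.map_perm, hs, Units.smul_def, map_zsmul,
      LinearMap.smul_apply, zsmul_eq_mul]
    push_cast
    ring

/-- `∑ (-1)^σ ⟨x, u_σ(1), …, u_σ(m)⟩ ⟨y, u_σ(m+1), …, u_σ(m+n)⟩ = ⟨x ∧ y, u_1, …, u_(m+n)⟩`, the
sum being over the shuffles. -/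
theorem sum_shuffles_pairing [CharZero K] {m n : ℕ} (x : Fin m → g) (y : Fin n → g)
    (u : Fin (m + n) → Dual K g) :
    ∑ σ ∈ shuffles (m + n) m n, ((Equiv.Perm.sign σ : ℤ) : K) *
      (exteriorPower.pairingDual K g m
          (exteriorPower.ιMulti K m fun i => u (σ (Fin.castAdd n i))) (exteriorPower.ιMulti K m x) *
        exteriorPower.pairingDual K g n
          (exteriorPower.ιMulti K n fun j => u (σ (Fin.natAdd m j)))
          (exteriorPower.ιMulti K n y)) =
      exteriorPower.pairingDual K g (m + n) (exteriorPower.ιMulti K _ u)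
        (exteriorPower.ιMulti K _ (Fin.append x y)) := by
  have h := card_smul_sum_shuffles_pairing n x (fun _ => y)
    (fun w => exteriorPower.pairingDual K g n (exteriorPower.ιMulti K n w)
      (exteriorPower.ιMulti K n y)) (fun w => pairingDual_ιMulti_eq_sum w y)
    (fun z _ w => by
      rw [AlternatingMap.map_perm, Units.smul_def, map_zsmul, LinearMap.smul_apply, zsmul_eq_mul]) u
  -- With middle length `n` all of `Fin n` is a single block, so the stabiliser is the whole
  -- symmetric group.
  have hZ : (Finset.univ.filter fun z : Equiv.Perm (Fin n) =>
      ∀ i, block 0 n (z i) = block 0 n i) = Finset.univ := by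
    simp [block]
  rw [hZ, Finset.sum_const] at h
  simp only [nsmul_eq_mul] at h
  exact mul_left_cancel₀ (Nat.cast_ne_zero.mpr Finset.univ_nonempty.card_ne_zero) h

/-- In the term of `z` in the determinant the form `w 0` meets the vector of index `z⁻¹ 0`, so
precomposing `w 0` with `t` amounts to applying `t` to that vector. -/
theorem pairingDual_ιMulti_cons_comp (t : g →ₗ[K] g) {k : ℕ} (w : Fin (k + 1) → Dual K g)
    (x : Fin (k + 1) → g) :
    exteriorPower.pairingDual K g (k + 1)
        (exteriorPower.ιMulti K (k + 1) (Fin.cons (w 0 ∘ₗ t) fun j => w j.succ))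
        (exteriorPower.ιMulti K (k + 1) x) =
      ∑ z : Equiv.Perm (Fin (k + 1)), ((Equiv.Perm.sign z : ℤ) : K) *
        ∏ j, w (z j) (Function.update x (z.symm 0) (t (x (z.symm 0))) j) := by
  rw [pairingDual_ιMulti_eq_sum]
  refine Finset.sum_congr rfl fun z _ => ?_
  congr 1
  refine Finset.prod_congr rfl fun j _ => ?_
  by_cases hj : j = z.symm 0
  · subst hj
    simp
  · rw [Function.update_of_ne hj]
    have : z j ≠ 0 := fun h => hj ((Equiv.eq_symm_apply z).mpr h)
    obtain ⟨l, hl⟩ := Fin.exists_succ_eq.mpr this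
    rw [← hl, Fin.cons_succ]

/-- The sum over the shuffles in `S_(m,1,k)` of
`(-1)^σ ⟨y, u_σ(1), …, u_σ(m)⟩ ⟨x, u_σ(m+1) ∘ t, u_σ(m+2), …⟩` is the value of
`∑ y ∧ x_1 ∧ ⋯ ∧ t(x_j) ∧ ⋯ ∧ x_(k+1)`. -/
theorem sum_shuffles_pairing_cons [CharZero K] {m k : ℕ} (t : g →ₗ[K] g) (y : Fin m → g)
    (x : Fin (k + 1) → g) (u : Fin (m + (k + 1)) → Dual K g) :
    ∑ σ ∈ shuffles (m + (k + 1)) m 1, ((Equiv.Perm.sign σ : ℤ) : K) *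
      (exteriorPower.pairingDual K g m
          (exteriorPower.ιMulti K m fun i => u (σ (Fin.castAdd (k + 1) i)))
          (exteriorPower.ιMulti K m y) *
        exteriorPower.pairingDual K g (k + 1)
          (exteriorPower.ιMulti K (k + 1)
            (Fin.cons (u (σ (Fin.natAdd m 0)) ∘ₗ t) fun j => u (σ (Fin.natAdd m j.succ))))
          (exteriorPower.ιMulti K (k + 1) x)) =
      ∑ j, exteriorPower.pairingDual K g (m + (k + 1)) (exteriorPower.ιMulti K _ u)
        (exteriorPower.ιMulti K _ (Fin.append y (Function.update x j (t (x j))))) := by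
  have h := card_smul_sum_shuffles_pairing 1 y
    (fun z : Equiv.Perm (Fin (k + 1)) => Function.update x (z.symm 0) (t (x (z.symm 0))))
    (fun w => exteriorPower.pairingDual K g (k + 1)
        (exteriorPower.ιMulti K (k + 1) (Fin.cons (w 0 ∘ₗ t) fun j => w j.succ))
        (exteriorPower.ιMulti K (k + 1) x)) (fun w => pairingDual_ιMulti_cons_comp t w x)
    (fun z hz w => by
      have hz0 : z 0 = 0 := eq_of_block_eq_one hz 0 rfl
      have e : (Fin.cons ((w ∘ z) 0 ∘ₗ t) (fun j => (w ∘ z) j.succ) : Fin (k + 1) → Dual K g) =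
          (Fin.cons (w 0 ∘ₗ t) (fun j => w j.succ) : Fin (k + 1) → Dual K g) ∘ z := by
        funext i
        refine Fin.cases ?_ (fun j => ?_) i
        · simp [hz0]
        · have : z j.succ ≠ 0 := fun h => Fin.succ_ne_zero j (z.injective (h.trans hz0.symm))
          obtain ⟨l, hl⟩ := Fin.exists_succ_eq.mpr this
          simp [← hl]
      rw [e, AlternatingMap.map_perm, Units.smul_def, map_zsmul, LinearMap.smul_apply,
        zsmul_eq_mul]) u
  rw [sum_perm_symm_zero fun j => exteriorPower.pairingDual K g (m + (k + 1))
    (exteriorPower.ιMulti K _ u)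
    (exteriorPower.ιMulti K _ (Fin.append y (Function.update x j (t (x j)))))] at h
  simp only [nsmul_eq_mul] at h
  refine mul_left_cancel₀ (Nat.cast_ne_zero.mpr ?_) h
  exact (Finset.card_pos.mpr ⟨1, by simp⟩).ne'

end Wedge
-- Derivations and graded commutativity of the exterior algebra
section Exterior

variable {K g : Type*} [Field K] [AddCommGroup g] [Module K g]

/-- The algebra map `a ↦ a + ε D(a)` for the derivation `D` of the exterior algebra extending a
linear map. -/
noncomputable def extDerivHom (f : g →ₗ[K] g) :
    ExteriorAlgebra K g →ₐ[K] DualNumber (ExteriorAlgebra K g) :=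
  -- The lift exists because `(m + ε f(m))² = 0`: its `ε`-part is `m f(m) + f(m) m`, which vanishes
  -- as degree-one elements anticommute. Multiplicativity of the lift then yields the Leibniz rule.
  ExteriorAlgebra.lift K
    ⟨(TrivSqZeroExt.inlAlgHom K (ExteriorAlgebra K g) (ExteriorAlgebra K g)).toLinearMap ∘ₗ
          ExteriorAlgebra.ι K +
        ((TrivSqZeroExt.inrHom (ExteriorAlgebra K g) (ExteriorAlgebra K g)).restrictScalars K ∘ₗ
          ExteriorAlgebra.ι K ∘ₗ f), fun m => by
      ext
      · simp
      · simp [ExteriorAlgebra.ι_add_mul_swap]⟩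

theorem fst_extDerivHom (f : g →ₗ[K] g) (a : ExteriorAlgebra K g) :
    (extDerivHom f a).fst = a := by
  have : (TrivSqZeroExt.fstHom K (ExteriorAlgebra K g) (ExteriorAlgebra K g)).comp
      (extDerivHom f) = AlgHom.id K _ := by
    ext m
    simp [extDerivHom]
  exact congrArg (fun F : ExteriorAlgebra K g →ₐ[K] ExteriorAlgebra K g => F a) this

/-- The derivation of the exterior algebra extending a linear map. -/
noncomputable def extDeriv (f : g →ₗ[K] g) : ExteriorAlgebra K g →ₗ[K] ExteriorAlgebra K g :=
  (TrivSqZeroExt.sndHom (ExteriorAlgebra K g) (ExteriorAlgebra K g)).restrictScalars K ∘ₗ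
    (extDerivHom f).toLinearMap

theorem extDeriv_ι (f : g →ₗ[K] g) (m : g) :
    extDeriv f (ExteriorAlgebra.ι K m) = ExteriorAlgebra.ι K (f m) := by
  simp [extDeriv, extDerivHom]

theorem extDeriv_one (f : g →ₗ[K] g) : extDeriv f 1 = 0 := by
  simp [extDeriv]

theorem extDeriv_mul (f : g →ₗ[K] g) (a b : ExteriorAlgebra K g) :
    extDeriv f (a * b) = extDeriv f a * b + a * extDeriv f b := by
  have ha := fst_extDerivHom f a
  have hb := fst_extDerivHom f b
  simp only [extDeriv, LinearMap.comp_apply, AlgHom.toLinearMap_apply, map_mul,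
    LinearMap.restrictScalars_apply, TrivSqZeroExt.sndHom_apply, TrivSqZeroExt.snd_mul, ha, hb]
  simp [add_comm]

/-- A derivation kills `1`, so it is determined by its values on generators. Linearity in `f` and
the commutator formula below are reduced to degree one in this way. -/
theorem extDeriv_unique {D D' : ExteriorAlgebra K g →ₗ[K] ExteriorAlgebra K g}
    (hD : ∀ a b, D (a * b) = D a * b + a * D b) (hD' : ∀ a b, D' (a * b) = D' a * b + a * D' b)
    (h : ∀ m, D (ExteriorAlgebra.ι K m) = D' (ExteriorAlgebra.ι K m)) (a : ExteriorAlgebra K g) :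
    D a = D' a := by
  have h1 : ∀ {D : ExteriorAlgebra K g →ₗ[K] ExteriorAlgebra K g},
      (∀ a b, D (a * b) = D a * b + a * D b) → D 1 = 0 := fun hD => by
    simpa using hD 1 1
  induction a using ExteriorAlgebra.induction with
  | algebraMap r => rw [Algebra.algebraMap_eq_smul_one, map_smul, map_smul, h1 hD, h1 hD']
  | ι x => exact h x
  | mul a b ha hb => rw [hD, hD', ha, hb]
  | add a b ha hb => rw [map_add, map_add, ha, hb]

theorem extDeriv_add (f f' : g →ₗ[K] g) (a : ExteriorAlgebra K g) :
    extDeriv (f + f') a = extDeriv f a + extDeriv f' a := by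
  refine extDeriv_unique (D := extDeriv (f + f')) (D' := extDeriv f + extDeriv f')
    (extDeriv_mul _) (fun a b => ?_) (fun m => ?_) a
  · simp only [LinearMap.add_apply, extDeriv_mul]
    noncomm_ring
  · simp [extDeriv_ι]

theorem extDeriv_smul (c : K) (f : g →ₗ[K] g) (a : ExteriorAlgebra K g) :
    extDeriv (c • f) a = c • extDeriv f a := by
  refine extDeriv_unique (D := extDeriv (c • f)) (D' := c • extDeriv f)
    (extDeriv_mul _) (fun a b => ?_) (fun m => ?_) a
  · simp only [LinearMap.smul_apply, extDeriv_mul, smul_add, smul_mul_assoc, mul_smul_comm]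
  · simp [extDeriv_ι]

theorem extDeriv_commutator (f f' h : g →ₗ[K] g) (hf : ∀ m, h m = f (f' m) - f' (f m))
    (a : ExteriorAlgebra K g) :
    extDeriv h a = extDeriv f (extDeriv f' a) - extDeriv f' (extDeriv f a) := by
  refine extDeriv_unique (D := extDeriv h)
    (D' := extDeriv f ∘ₗ extDeriv f' - extDeriv f' ∘ₗ extDeriv f)
    (extDeriv_mul _) (fun a b => ?_) (fun m => ?_) a
  · simp only [LinearMap.sub_apply, LinearMap.comp_apply, extDeriv_mul, map_add]
    noncomm_ring
  · simp [extDeriv_ι, hf]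

/-- This is the iterated Leibniz rule; it matches the derivation with the sums produced by the
insertion terms. -/
theorem extDeriv_ιMulti (f : g →ₗ[K] g) {n : ℕ} (x : Fin n → g) :
    extDeriv f (ExteriorAlgebra.ιMulti K n x) =
      ∑ j, ExteriorAlgebra.ιMulti K n (Function.update x j (f (x j))) := by
  induction n with
  | zero => simp [extDeriv_one]
  | succ n ih =>
    rw [Fin.sum_univ_succ]
    simp only [ExteriorAlgebra.ιMulti_succ_apply, extDeriv_mul, ih, extDeriv_ι, Finset.mul_sum,
      Function.update_self]
    have htail : ∀ (j : Fin n) (v : g), Matrix.vecTail (Function.update x j.succ v) =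
        Function.update (Matrix.vecTail x) j v := fun j v =>
      Function.update_comp_eq_of_injective x (Fin.succ_injective n) j v
    have hzero : ∀ v, Matrix.vecTail (Function.update x 0 v) = Matrix.vecTail x := fun v => by
      funext i
      simp [Matrix.vecTail]
    simp only [htail, hzero, Function.update_of_ne (Fin.succ_ne_zero _).symm]
    rfl

theorem ι_mul_ιMulti (m : g) {l : ℕ} (y : Fin l → g) :
    ExteriorAlgebra.ι K m * ExteriorAlgebra.ιMulti K l y =
      (-1 : K) ^ l • (ExteriorAlgebra.ιMulti K l y * ExteriorAlgebra.ι K m) := by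
  induction l with
  | zero => simp
  | succ l ih =>
    have h := eq_neg_of_add_eq_zero_left (ExteriorAlgebra.ι_add_mul_swap (R := K) m (y 0))
    rw [ExteriorAlgebra.ιMulti_succ_apply, ← mul_assoc, h, neg_mul, mul_assoc, ih, pow_succ,
      mul_smul_comm, mul_assoc]
    simp

theorem ιMulti_mul_comm {k l : ℕ} (x : Fin k → g) (y : Fin l → g) :
    ExteriorAlgebra.ιMulti K k x * ExteriorAlgebra.ιMulti K l y =
      (-1 : K) ^ (k * l) • (ExteriorAlgebra.ιMulti K l y * ExteriorAlgebra.ιMulti K k x) := by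
  induction k with
  | zero => simp
  | succ k ih =>
    rw [ExteriorAlgebra.ιMulti_succ_apply, mul_assoc, ih, mul_smul_comm, ← mul_assoc, ι_mul_ιMulti,
      smul_mul_assoc, smul_smul, mul_assoc]
    congr 1
    ring

/-- The exterior algebra is graded commutative. -/
theorem exteriorPower_mul_comm {k l : ℕ} {a b : ExteriorAlgebra K g} (ha : a ∈ ⋀[K]^k g)
    (hb : b ∈ ⋀[K]^l g) : a * b = (-1 : K) ^ (k * l) • (b * a) := by
  rw [← exteriorPower.ιMulti_span_fixedDegree] at ha hb
  induction ha, hb using Submodule.span_induction₂ with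
  | mem_mem x y hx hy =>
    obtain ⟨x, rfl⟩ := hx
    obtain ⟨y, rfl⟩ := hy
    exact ιMulti_mul_comm x y
  | zero_left => simp
  | zero_right => simp
  | add_left x y z _ _ _ h₁ h₂ => rw [add_mul, mul_add, h₁, h₂, smul_add]
  | add_right x y z _ _ _ h₁ h₂ => rw [add_mul, mul_add, h₁, h₂, smul_add]
  | smul_left c x y _ _ h => rw [smul_mul_assoc, mul_smul_comm, h, smul_comm]
  | smul_right c x y _ _ h => rw [smul_mul_assoc, mul_smul_comm, h, smul_comm]

theorem extDeriv_mem (f : g →ₗ[K] g) {k : ℕ} {a : ExteriorAlgebra K g} (ha : a ∈ ⋀[K]^k g) :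
    extDeriv f a ∈ ⋀[K]^k g := by
  rw [← exteriorPower.ιMulti_span_fixedDegree] at ha
  induction ha using Submodule.span_induction with
  | mem x hx =>
    obtain ⟨x, rfl⟩ := hx
    rw [extDeriv_ιMulti]
    exact Submodule.sum_mem _ fun j _ => ExteriorAlgebra.ιMulti_range K k (Set.mem_range_self _)
  | zero => simp
  | add x y _ _ hx hy => rw [map_add]; exact Submodule.add_mem _ hx hy
  | smul c x _ hx => rw [map_smul]; exact Submodule.smul_mem _ c hx

end Exterior
-- The action Lie algebroid bracket on `Λ ⊗ g`
section ExtBracket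

variable {K g : Type*} [Field K] [LeftPreLieRing g] [LeftPreLieAlgebra K g]

/-- The action of `g` on its exterior algebra by the derivations extending the left
multiplications. -/
noncomputable def extAct (K g : Type*) [Field K] [LeftPreLieRing g] [LeftPreLieAlgebra K g] :
    g →ₗ[K] ExteriorAlgebra K g →ₗ[K] ExteriorAlgebra K g where
  toFun x := extDeriv (LinearMap.mulLeft K x)
  map_add' x y := by
    refine LinearMap.ext fun a => ?_
    rw [LinearMap.add_apply, ← extDeriv_add]
    congr 2
    ext z
    simp [add_mul]
  map_smul' c x := by
    refine LinearMap.ext fun a => ?_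
    rw [RingHom.id_apply, LinearMap.smul_apply, ← extDeriv_smul]
    congr 2
    ext z
    simp [smul_mul_assoc]

theorem extAct_apply (x : g) (a : ExteriorAlgebra K g) :
    extAct K g x a = extDeriv (LinearMap.mulLeft K x) a := rfl

theorem extAct_mul (x : g) (a b : ExteriorAlgebra K g) :
    extAct K g x (a * b) = extAct K g x a * b + a * extAct K g x b :=
  extDeriv_mul _ a b

/-- On generators this is the pre-Lie identity; both sides are derivations in `a`. -/
theorem extAct_lie (x y : g) (a : ExteriorAlgebra K g) :
    extAct K g ⁅x, y⁆ a = extAct K g x (extAct K g y a) - extAct K g y (extAct K g x a) := by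
  refine extDeriv_commutator _ _ _ (fun z => ?_) a
  have h := LeftPreLieRing.assoc_symm x y z
  simp only [associator_apply] at h
  simp only [LinearMap.mulLeft_apply, Ring.lie_def, sub_mul]
  grind

theorem extAct_mem (x : g) {k : ℕ} {a : ExteriorAlgebra K g} (ha : a ∈ ⋀[K]^k g) :
    extAct K g x a ∈ ⋀[K]^k g :=
  extDeriv_mem _ ha

/-- The bilinear operation `(a ⊗ x, b ⊗ y) ↦ m(a, x · b) ⊗ y` on `⋀ g ⊗ g`. -/
noncomputable def actSecond
    (m : ExteriorAlgebra K g →ₗ[K] ExteriorAlgebra K g →ₗ[K] ExteriorAlgebra K g) :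
    ExteriorAlgebra K g ⊗[K] g →ₗ[K] ExteriorAlgebra K g ⊗[K] g →ₗ[K] ExteriorAlgebra K g ⊗[K] g :=
  LinearMap.rTensorHom g ∘ₗ TensorProduct.lift
    ((LinearMap.llcomp K (ExteriorAlgebra K g) (ExteriorAlgebra K g) (ExteriorAlgebra K g) ∘ₗ
      m).compl₂ (extAct K g))

theorem actSecond_tmul
    (m : ExteriorAlgebra K g →ₗ[K] ExteriorAlgebra K g →ₗ[K] ExteriorAlgebra K g)
    (a b : ExteriorAlgebra K g) (x y : g) :
    actSecond m (a ⊗ₜ[K] x) (b ⊗ₜ[K] y) = m a (extAct K g x b) ⊗ₜ[K] y := by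
  simp [actSecond]

/-- The bilinear operation `[a ⊗ x, b ⊗ y] = ab ⊗ [x, y] + a (x · b) ⊗ y - (y · a) b ⊗ x` on
`⋀ g ⊗ g`. -/
noncomputable def extBracket (K g : Type*) [Field K] [LeftPreLieRing g] [LeftPreLieAlgebra K g] :
    ExteriorAlgebra K g ⊗[K] g →ₗ[K] ExteriorAlgebra K g ⊗[K] g →ₗ[K] ExteriorAlgebra K g ⊗[K] g :=
  TensorProduct.map₂ (LinearMap.mul K (ExteriorAlgebra K g))
      (LinearMap.mul K g - (LinearMap.mul K g).flip) +
    actSecond (LinearMap.mul K (ExteriorAlgebra K g)) +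
    (-1 : K) • (actSecond (LinearMap.mul K (ExteriorAlgebra K g)).flip).flip

theorem extBracket_tmul (a b : ExteriorAlgebra K g) (x y : g) :
    extBracket K g (a ⊗ₜ[K] x) (b ⊗ₜ[K] y) = (a * b) ⊗ₜ[K] ⁅x, y⁆ +
      (a * extAct K g x b) ⊗ₜ[K] y - (extAct K g y a * b) ⊗ₜ[K] x := by
  simp [extBracket, actSecond_tmul, Ring.lie_def, sub_eq_add_neg]

theorem extBracket_skew {i j : ℕ} {a b : ExteriorAlgebra K g} (ha : a ∈ ⋀[K]^i g)
    (hb : b ∈ ⋀[K]^j g) (x y : g) :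
    extBracket K g (a ⊗ₜ[K] x) (b ⊗ₜ[K] y) =
      (-(-1 : K) ^ (i * j)) • extBracket K g (b ⊗ₜ[K] y) (a ⊗ₜ[K] x) := by
  rw [extBracket_tmul, extBracket_tmul, exteriorPower_mul_comm ha hb,
    exteriorPower_mul_comm ha (extAct_mem x hb), exteriorPower_mul_comm (extAct_mem y ha) hb,
    ← lie_skew y x]
  simp only [TensorProduct.tmul_neg, ← TensorProduct.smul_tmul', smul_add, smul_sub, neg_smul,
    smul_neg]
  abel

/-- In every expanded term the factor coming from `c` stands rightmost, so `c` is never commuted and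
need not be homogeneous. -/
theorem extBracket_jacobi {i j : ℕ} {a b : ExteriorAlgebra K g} (c : ExteriorAlgebra K g)
    (ha : a ∈ ⋀[K]^i g) (hb : b ∈ ⋀[K]^j g) (x y z : g) :
    extBracket K g (a ⊗ₜ[K] x) (extBracket K g (b ⊗ₜ[K] y) (c ⊗ₜ[K] z)) =
      extBracket K g (extBracket K g (a ⊗ₜ[K] x) (b ⊗ₜ[K] y)) (c ⊗ₜ[K] z) +
      (-1 : K) ^ (i * j) •
        extBracket K g (b ⊗ₜ[K] y) (extBracket K g (a ⊗ₜ[K] x) (c ⊗ₜ[K] z)) := by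
  -- The sign in front of the last term is exactly what restores the order `a`, `b`. It is needed
  -- for the derivatives of `a` and `b` as well, which have the same degrees.
  have comm : ∀ {a b : ExteriorAlgebra K g}, a ∈ ⋀[K]^i g → b ∈ ⋀[K]^j g →
      ∀ (d : ExteriorAlgebra K g) (w : g),
      (-1 : K) ^ (i * j) • ((b * (a * d)) ⊗ₜ[K] w) = (a * (b * d)) ⊗ₜ[K] w := by
    intro a b ha hb d w
    rw [← mul_assoc, ← mul_assoc, exteriorPower_mul_comm ha hb, smul_mul_assoc,
      TensorProduct.smul_tmul']
  have da : ∀ w, extAct K g w a ∈ ⋀[K]^i g := fun w => extAct_mem w ha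
  have db : ∀ w, extAct K g w b ∈ ⋀[K]^j g := fun w => extAct_mem w hb
  have dda : ∀ w w', extAct K g w (extAct K g w' a) ∈ ⋀[K]^i g := fun w w' => extAct_mem w (da w')
  have ddb : ∀ w w', extAct K g w (extAct K g w' b) ∈ ⋀[K]^j g := fun w w' => extAct_mem w (db w')
  simp only [extBracket_tmul, map_add, map_sub, LinearMap.add_apply, LinearMap.sub_apply,
    extAct_mul, extAct_lie, mul_add, add_mul, mul_sub, sub_mul, TensorProduct.add_tmul,
    TensorProduct.sub_tmul, mul_assoc, smul_add, smul_sub, comm ha hb, comm (da _) hb,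
    comm ha (db _), comm (da _) (db _), comm (dda _ _) hb, comm ha (ddb _ _)]
  rw [leibniz_lie x y z, ← lie_skew y x]
  simp only [TensorProduct.tmul_add, TensorProduct.tmul_neg]
  abel

end ExtBracket
-- Comparison of the two brackets and the graded Lie identities
section SBracket

open Module

variable {K g : Type*} [Field K] [LeftPreLieRing g] [LeftPreLieAlgebra K g]

theorem shuffleLie_psiLinear [CharZero K] {k l : ℕ} (x : Fin k → g) (y : Fin l → g) (a b : g)
    (u : Fin (k + l) → Dual K g) :
    shuffleLie (psiLinear k (exteriorPower.ιMulti K k x ⊗ₜ[K] a))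
        (psiLinear l (exteriorPower.ιMulti K l y ⊗ₜ[K] b)) u =
      exteriorPower.pairingDual K g (k + l) (exteriorPower.ιMulti K _ u)
        (exteriorPower.ιMulti K _ (Fin.append x y)) • ⁅a, b⁆ := by
  rw [shuffleLie_apply, ← sum_shuffles_pairing, Finset.sum_smul]
  refine Finset.sum_congr rfl fun σ _ => ?_
  rw [psiLinear_tmul, psiLinear_tmul, smul_lie, lie_smul, smul_smul, ← Int.cast_smul_eq_zsmul K,
    smul_smul]

/-- The value of the inner map is a scalar times `b`, and `L^*_b v = -v ∘ L_b` turns the action on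
forms into left multiplication on the vectors `x i`, whence the minus sign. -/
theorem insertion_psiLinear [CharZero K] {k l : ℕ} (x : Fin k → g) (y : Fin l → g) (a b : g)
    (u : Fin (l + k) → Dual K g) :
    insertion (lStar K g) (psiLinear k (exteriorPower.ιMulti K k x ⊗ₜ[K] a))
        (psiLinear l (exteriorPower.ιMulti K l y ⊗ₜ[K] b)) u =
      -((∑ i, exteriorPower.pairingDual K g (l + k) (exteriorPower.ιMulti K _ u)
        (exteriorPower.ιMulti K _ (Fin.append y (Function.update x i (b * x i))))) • a) := by
  cases k with
  | zero => simp [insertion]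
  | succ k =>
    have h := sum_shuffles_pairing_cons (LinearMap.mulLeft K b) y x u
    simp only [LinearMap.mulLeft_apply] at h
    rw [insertion, insertSucc_apply, ← h, Finset.sum_smul, ← Finset.sum_neg_distrib]
    refine Finset.sum_congr rfl fun σ _ => ?_
    have hl : ∀ (c : K) (v : Dual K g),
        lStar K g (c • b) v = (-c) • (v ∘ₗ LinearMap.mulLeft K b) := by
      intro c v
      ext z
      simp [lStar_apply]
    have hcons : ∀ (c : K) (v : Dual K g) (w : Fin k → Dual K g),
        exteriorPower.ιMulti K (k + 1) (Fin.cons (c • v) w) =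
          c • exteriorPower.ιMulti K (k + 1) (Fin.cons v w) := fun c v w =>
      (exteriorPower.ιMulti K (k + 1)).map_vecCons_smul w c v
    rw [psiLinear_tmul, psiLinear_tmul, hl, hcons, map_smul, LinearMap.smul_apply,
      ← Int.cast_smul_eq_zsmul K, smul_smul, ← neg_smul]
    congr 1
    rw [smul_eq_mul]
    ring

/-- The degrees `l + k` and `k + l` give different types; comparison inside the exterior algebra
avoids transport. -/
theorem pairingDual_cast {N N' : ℕ} (h : N' = N) (u : Fin N → Dual K g) (c : K) (ω : ⋀[K]^N g)
    (ω' : ⋀[K]^N' g) (hω : (ω' : ExteriorAlgebra K g) = c • (ω : ExteriorAlgebra K g)) :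
    exteriorPower.pairingDual K g N' (exteriorPower.ιMulti K N' fun i => u (Fin.cast h i)) ω' =
      c * exteriorPower.pairingDual K g N (exteriorPower.ιMulti K N u) ω := by
  subst h
  have : ω' = c • ω := Subtype.ext hω
  rw [this, map_smul, smul_eq_mul]
  rfl

/-- Two of the three terms carry `(-1)^(kl)` by definition; the remaining insertion acquires it when
its wedge factors are reordered, so the sign factors out. -/
theorem sBracket_ιMulti_tmul [CharZero K] [FiniteDimensional K g] {k l : ℕ} (x : Fin k → g)
    (y : Fin l → g) (a b : g) :
    sBracket K g k l (exteriorPower.ιMulti K k x ⊗ₜ[K] a) (exteriorPower.ιMulti K l y ⊗ₜ[K] b) =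
      (-1 : K) ^ (k * l) • (exteriorPower.ιMulti K (k + l) (Fin.append x y) ⊗ₜ[K] ⁅a, b⁆ +
        (∑ j, exteriorPower.ιMulti K (k + l)
          (Fin.append x (Function.update y j (a * y j)))) ⊗ₜ[K] b -
        (∑ i, exteriorPower.ιMulti K (k + l)
          (Fin.append (Function.update x i (b * x i)) y)) ⊗ₜ[K] a) := by
  rw [sBracket_apply, upsilon, LinearEquiv.symm_apply_eq]
  ext u
  change homBracket (lStar K g) (psiLinear k _) (psiLinear l _) u = psiLinear (k + l) _ u
  -- The first insertion puts `y` before `x`; restoring the order costs `(-1)^(kl)`.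
  have hswap : ∀ i, exteriorPower.pairingDual K g (l + k)
      (exteriorPower.ιMulti K (l + k) fun i => u (Fin.cast (Nat.add_comm l k) i))
      (exteriorPower.ιMulti K _ (Fin.append y (Function.update x i (b * x i)))) =
        (-1 : K) ^ (k * l) * exteriorPower.pairingDual K g (k + l) (exteriorPower.ιMulti K _ u)
          (exteriorPower.ιMulti K _ (Fin.append (Function.update x i (b * x i)) y)) := fun i => by
    refine pairingDual_cast _ u _ _ _ ?_
    rw [exteriorPower.ιMulti_apply_coe, exteriorPower.ιMulti_apply_coe,
      ← ExteriorAlgebra.ιMulti_mul_ιMulti, ← ExteriorAlgebra.ιMulti_mul_ιMulti, ιMulti_mul_comm,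
      mul_comm l k]
  have h1 : ((insertion (lStar K g) (psiLinear k (exteriorPower.ιMulti K k x ⊗ₜ[K] a))
        (psiLinear l (exteriorPower.ιMulti K l y ⊗ₜ[K] b))).domDomCongr
          (finCongr (Nat.add_comm l k))) u = _ :=
    insertion_psiLinear x y a b fun i => u (Fin.cast (Nat.add_comm l k) i)
  simp only [hswap] at h1
  rw [homBracket, AlternatingMap.add_apply, AlternatingMap.sub_apply, AlternatingMap.smul_apply,
    AlternatingMap.smul_apply, h1, insertion_psiLinear, shuffleLie_psiLinear]
  simp only [map_smul, map_add, map_sub, AlternatingMap.smul_apply, AlternatingMap.add_apply,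
    AlternatingMap.sub_apply, psiLinear_tmul, map_sum, ← Finset.mul_sum, mul_smul, mul_comm l k]
  module

/-- The inclusion `⋀ᵏ g ⊗ g → ⋀ g ⊗ g`. -/
noncomputable def toExt (K g : Type*) [Field K] [AddCommGroup g] [Module K g] (k : ℕ) :
    Cochain K g k →ₗ[K] ExteriorAlgebra K g ⊗[K] g :=
  LinearMap.rTensor g (⋀[K]^k g).subtype

theorem toExt_injective (k : ℕ) : Function.Injective (toExt K g k) :=
  Module.Flat.rTensor_preserves_injective_linearMap _ (Submodule.subtype_injective _)

theorem toExt_tmul {k : ℕ} (ω : ⋀[K]^k g) (a : g) :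
    toExt K g k (ω ⊗ₜ[K] a) = (ω : ExteriorAlgebra K g) ⊗ₜ[K] a := rfl

/-- Linear maps on `⋀ᵏ g ⊗ g` agreeing on the tensors `x_1 ∧ ⋯ ∧ x_k ⊗ a` are equal. -/
theorem cochain_ext {k : ℕ} {M : Type*} [AddCommGroup M] [Module K M]
    {f f' : Cochain K g k →ₗ[K] M}
    (h : ∀ (x : Fin k → g) (a : g), f (exteriorPower.ιMulti K k x ⊗ₜ[K] a) =
      f' (exteriorPower.ιMulti K k x ⊗ₜ[K] a)) : f = f' := by
  refine TensorProduct.ext (exteriorPower.linearMap_ext ?_)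
  ext x a
  exact h x a

/-- Up to the sign `(-1)^(kl)`, the bracket is induced by the one on `⋀ g ⊗ g`. -/
theorem toExt_sBracket [CharZero K] [FiniteDimensional K g] {k l : ℕ} (φ : Cochain K g k)
    (ϕ : Cochain K g l) :
    toExt K g (k + l) (sBracket K g k l φ ϕ) =
      (-1 : K) ^ (k * l) • extBracket K g (toExt K g k φ) (toExt K g l ϕ) := by
  have h : (sBracket K g k l).compr₂ (toExt K g (k + l)) =
      (-1 : K) ^ (k * l) • (extBracket K g).compl₁₂ (toExt K g k) (toExt K g l) := by
    refine cochain_ext fun x a => cochain_ext fun y b => ?_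
    simp only [LinearMap.compr₂_apply, LinearMap.smul_apply, LinearMap.compl₁₂_apply, toExt_tmul,
      sBracket_ιMulti_tmul, map_smul, map_add, map_sub, extBracket_tmul, extAct_apply,
      exteriorPower.ιMulti_apply_coe, extDeriv_ιMulti, LinearMap.mulLeft_apply, Finset.mul_sum,
      Finset.sum_mul, ExteriorAlgebra.ιMulti_mul_ιMulti, AddSubmonoidClass.coe_finsetSum]
  exact LinearMap.congr_fun (LinearMap.congr_fun h φ) ϕ

theorem toExt_skew {k l : ℕ} (φ : Cochain K g k) (ϕ : Cochain K g l) :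
    extBracket K g (toExt K g k φ) (toExt K g l ϕ) =
      (-(-1 : K) ^ (k * l)) • extBracket K g (toExt K g l ϕ) (toExt K g k φ) := by
  have h : (extBracket K g).compl₁₂ (toExt K g k) (toExt K g l) =
      (-(-1 : K) ^ (k * l)) • ((extBracket K g).compl₁₂ (toExt K g l) (toExt K g k)).flip := by
    refine TensorProduct.ext' fun ω a => TensorProduct.ext' fun η b => ?_
    exact extBracket_skew ω.2 η.2 a b
  exact LinearMap.congr_fun (LinearMap.congr_fun h φ) ϕ

theorem toExt_jacobi {i j : ℕ} (φ : Cochain K g i) (ϕ : Cochain K g j)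
    (U : ExteriorAlgebra K g ⊗[K] g) :
    extBracket K g (toExt K g i φ) (extBracket K g (toExt K g j ϕ) U) =
      extBracket K g (extBracket K g (toExt K g i φ) (toExt K g j ϕ)) U +
      (-1 : K) ^ (i * j) •
        extBracket K g (toExt K g j ϕ) (extBracket K g (toExt K g i φ) U) := by
  induction φ using TensorProduct.induction_on with
  | zero => simp
  | add φ φ' h h' => simp only [map_add, LinearMap.add_apply, h, h', smul_add]; abel
  | tmul ω a =>
    induction ϕ using TensorProduct.induction_on with
    | zero => simp
    | add φ φ' h h' => simp only [map_add, LinearMap.add_apply, h, h', smul_add]; abel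
    | tmul η b =>
      induction U using TensorProduct.induction_on with
      | zero => simp
      | add φ φ' h h' => simp only [map_add, h, h', smul_add]; abel
      | tmul c z => exact extBracket_jacobi c ω.2 η.2 a b z

/-- Identities in the direct sum between components whose indices are only propositionally equal can
be checked in the single space `Λ ⊗ g`, because `toExt` is injective in each degree. -/
theorem lof_eq_of_toExt_eq {p q : ℕ} (h : q = p) (s : K) {φ : Cochain K g p} {ϕ : Cochain K g q}
    (he : toExt K g p φ = s • toExt K g q ϕ) :
    DirectSum.lof K ℕ (Cochain K g) p φ = s • DirectSum.lof K ℕ (Cochain K g) q ϕ := by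
  subst h
  rw [← map_smul] at he
  rw [toExt_injective _ he, map_smul]

theorem lof_eq_add_of_toExt_eq {p q r : ℕ} (hq : q = p) (hr : r = p) (s : K) {φ : Cochain K g p}
    {ϕ : Cochain K g q} {χ : Cochain K g r}
    (he : toExt K g p φ = toExt K g q ϕ + s • toExt K g r χ) :
    DirectSum.lof K ℕ (Cochain K g) p φ =
      DirectSum.lof K ℕ (Cochain K g) q ϕ + s • DirectSum.lof K ℕ (Cochain K g) r χ := by
  subst hq hr
  rw [← map_smul, ← map_add] at he
  rw [toExt_injective _ he, map_add, map_smul]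

/-- `⟦-, -⟧_s` is a graded Lie bracket. -/
theorem isGradedLieBracket_sBracketTotal [CharZero K] [FiniteDimensional K g] :
    IsGradedLieBracket (sBracketTotal K g) where
  degree i j x y := ⟨_, totalBracket_lof _ i j x y⟩
  skew i j x y := by
    simp only [sBracketTotal, totalBracket_lof]
    refine lof_eq_of_toExt_eq (Nat.add_comm j i) _ ?_
    rw [toExt_sBracket, toExt_sBracket, toExt_skew x y, smul_comm, mul_comm j i]
  jacobi i j k x y z := by
    simp only [sBracketTotal, totalBracket_lof]
    refine lof_eq_add_of_toExt_eq (by omega) (by omega) _ ?_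
    simp only [toExt_sBracket, map_smul, LinearMap.smul_apply, toExt_jacobi x y, smul_add,
      smul_smul, ← pow_add]
    -- Only the exponents of `-1` remain to be compared; up to the explicit `ij` of the last term,
    -- each is `ij + jk + ik`.
    congr 3 <;> ring

end SBracket
-- Symmetric tensors and Maurer–Cartan elements
section Tensor

open Module

variable {K g : Type*} [Field K] [LeftPreLieRing g] [LeftPreLieAlgebra K g]

theorem evalTriple_tmul (a b c : g) (α₁ α₂ α₃ : Dual K g) :
    evalTriple (a ⊗ₜ[K] (b ⊗ₜ[K] c)) α₁ α₂ α₃ = α₁ a * (α₂ b * α₃ c) := by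
  simp [evalTriple]

theorem evalTriple_add (s t : g ⊗[K] (g ⊗[K] g)) (α₁ α₂ α₃ : Dual K g) :
    evalTriple (s + t) α₁ α₂ α₃ = evalTriple s α₁ α₂ α₃ + evalTriple t α₁ α₂ α₃ :=
  map_add _ _ _

theorem evalTriple_neg (t : g ⊗[K] (g ⊗[K] g)) (α₁ α₂ α₃ : Dual K g) :
    evalTriple (-t) α₁ α₂ α₃ = -evalTriple t α₁ α₂ α₃ :=
  map_neg _ _

/-- The coordinates of `t` in the tensor product basis are its values on triples of coordinate
forms. -/
theorem eq_zero_of_evalTriple_eq_zero [FiniteDimensional K g] {t : g ⊗[K] (g ⊗[K] g)}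
    (h : ∀ α₁ α₂ α₃ : Dual K g, evalTriple t α₁ α₂ α₃ = 0) : t = 0 := by
  let b := Module.finBasis K g
  apply (b.tensorProduct (b.tensorProduct b)).repr.injective
  ext ⟨i, j, k⟩
  rw [map_zero, Finsupp.zero_apply, ← h (b.coord i) (b.coord j) (b.coord k)]
  have : Finsupp.lapply (i, j, k) ∘ₗ (b.tensorProduct (b.tensorProduct b)).repr.toLinearMap =
      TensorProduct.dualDistrib K g (g ⊗[K] g) (b.coord i ⊗ₜ[K]
        TensorProduct.dualDistrib K g g (b.coord j ⊗ₜ[K] b.coord k)) := by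
    ext x y z
    simp
    ring
  exact LinearMap.congr_fun this t

theorem toCochain_tmul (a b : g) :
    toCochain (a ⊗ₜ[K] b) = exteriorPower.ιMulti K 1 (fun _ => a) ⊗ₜ[K] b := by
  simp [toCochain, exteriorPower.oneEquiv]

theorem toCochain_add (r s : g ⊗[K] g) : toCochain (r + s) = toCochain r + toCochain s :=
  map_add _ _ _

theorem Cochain.eval_add {k : ℕ} (φ ϕ : Cochain K g k) (α : Fin k → Dual K g) (β : Dual K g) :
    (φ + ϕ).eval α β = φ.eval α β + ϕ.eval α β :=
  map_add _ _ _

theorem eq_zero_of_eval_eq_zero [FiniteDimensional K g] {k : ℕ} {φ : Cochain K g k}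
    (h : ∀ α β, φ.eval α β = 0) : φ = 0 := by
  apply (psiLinear_bijective k).1
  rw [map_zero]
  ext α
  rw [AlternatingMap.zero_apply, ← Module.forall_dual_apply_eq_zero_iff K]
  intro β
  rw [apply_psiLinear, h]

variable [CharZero K] [FiniteDimensional K g]

/-- The outer minus sign is `(-1)^(1 · 1)`, and each wedge of two vectors evaluates to a two-by-two
determinant. -/
theorem eval_sBracket_tmul (a b c d : g) (α₁ α₂ α₃ : Dual K g) :
    (sBracket K g 1 1 (toCochain (a ⊗ₜ[K] b)) (toCochain (c ⊗ₜ[K] d))).eval ![α₁, α₂] α₃ =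
      -((α₁ a * α₂ c - α₂ a * α₁ c) * α₃ ⁅b, d⁆ + (α₁ a * α₂ (b * c) - α₂ a * α₁ (b * c)) * α₃ d -
        (α₁ (d * a) * α₂ c - α₂ (d * a) * α₁ c) * α₃ b) := by
  rw [toCochain_tmul, toCochain_tmul, sBracket_ιMulti_tmul, ← apply_psiLinear]
  have hp : ∀ x y : Fin 1 → g, exteriorPower.pairingDual K g (1 + 1)
      (exteriorPower.ιMulti K (1 + 1) ![α₁, α₂]) (exteriorPower.ιMulti K (1 + 1) (Fin.append x y)) =
      α₁ (x 0) * α₂ (y 0) - α₂ (x 0) * α₁ (y 0) := by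
    intro x y
    rw [exteriorPower.pairingDual_ιMulti_ιMulti]
    have h0 : Fin.append x y 0 = x 0 := Fin.append_left x y 0
    have h1 : Fin.append x y 1 = y 0 := Fin.append_right x y 0
    erw [Matrix.det_fin_two]
    simp [h0, h1]
  simp [psiLinear_tmul, hp]

/-- The polarized form of `⟦r, r⟧_s(α₁, α₂, α₃)` in terms of the operations defining `[r, r]`. -/
theorem eval_sBracket_toCochain (r s : g ⊗[K] g) (α₁ α₂ α₃ : Dual K g) :
    (sBracket K g 1 1 (toCochain r) (toCochain s)).eval ![α₁, α₂] α₃ =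
      evalTriple (mul12_13 (TensorProduct.comm K g g r ⊗ₜ[K] s)) α₁ α₂ α₃ +
      evalTriple (mul12_13 (TensorProduct.comm K g g s ⊗ₜ[K] r)) α₁ α₂ α₃ -
      evalTriple (mul12_23 (r ⊗ₜ[K] s)) α₁ α₂ α₃ - evalTriple (mul12_23 (s ⊗ₜ[K] r)) α₁ α₂ α₃ -
      evalTriple (lie13_23 (r ⊗ₜ[K] s)) α₁ α₂ α₃ - evalTriple (lie13_23 (s ⊗ₜ[K] r)) α₁ α₂ α₃ := by
  induction r using TensorProduct.induction_on with
  | zero => simp [toCochain, Cochain.eval, evalTriple]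
  | add r r' h h' =>
    simp only [toCochain_add, map_add, LinearMap.add_apply, Cochain.eval_add, h, h',
      TensorProduct.add_tmul, TensorProduct.tmul_add, evalTriple_add]
    ring
  | tmul a b =>
    induction s using TensorProduct.induction_on with
    | zero => simp [toCochain, Cochain.eval, evalTriple]
    | add r r' h h' =>
      simp only [toCochain_add, map_add, Cochain.eval_add, h, h',
        TensorProduct.add_tmul, TensorProduct.tmul_add, evalTriple_add]
      ring
    | tmul c d =>
      rw [eval_sBracket_tmul, TensorProduct.comm_tmul, TensorProduct.comm_tmul]
      simp only [mul12_13_tmul, mul12_23_tmul, lie13_23_tmul, evalTriple_tmul]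
      rw [← lie_skew b d, map_neg]
      ring

theorem eval_sBracket_eq {r : g ⊗[K] g} (hr : IsSymmTensor r) (α₁ α₂ α₃ : Dual K g) :
    (sBracket K g 1 1 (toCochain r) (toCochain r)).eval ![α₁, α₂] α₃ =
      -2 * evalTriple (sTensor r) α₁ α₂ α₃ := by
  -- Symmetry of `r` enters only here, to remove the flip in the two `mul12_13` terms.
  rw [eval_sBracket_toCochain, hr, sTensor, evalTriple_add, evalTriple_add, evalTriple_neg]
  ring

theorem isSMatrix_iff {r : g ⊗[K] g} (hr : IsSymmTensor r) :
    IsSMatrix r ↔ IsMaurerCartan (sBracketTotal K g) (toCochain r) := by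
  rw [IsMaurerCartan, sBracketTotal, totalBracket_lof,
    smul_eq_zero_iff_right (one_div_ne_zero two_ne_zero)]
  constructor
  · rintro ⟨-, h⟩
    rw [eq_zero_of_eval_eq_zero (φ := sBracket K g 1 1 (toCochain r) (toCochain r)), map_zero]
    intro α β
    have hα : α = ![α 0, α 1] := by
      funext i
      fin_cases i <;> rfl
    rw [hα, eval_sBracket_eq hr, h]
    simp [evalTriple]
  · intro h
    have h0 : sBracket K g 1 1 (toCochain r) (toCochain r) = 0 :=
      DirectSum.of_injective (β := Cochain K g) (1 + 1) (h.trans (map_zero _).symm)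
    refine ⟨hr, eq_zero_of_evalTriple_eq_zero fun α₁ α₂ α₃ => ?_⟩
    have h2 := eval_sBracket_eq hr α₁ α₂ α₃
    rw [h0] at h2
    have h3 : (0 : Cochain K g (1 + 1)).eval ![α₁, α₂] α₃ = 0 := map_zero _
    rw [h3] at h2
    simpa using h2.symm

end Tensor
end SMatrix

theorem mainTheorem1 {K g : Type*} [Field K] [CharZero K] [LeftPreLieRing g]
    [LeftPreLieAlgebra K g] [FiniteDimensional K g] :
    SMatrix.IsGradedLieBracket (SMatrix.sBracketTotal K g) ∧
    ∀ r : g ⊗[K] g, SMatrix.IsSymmTensor r →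
      (SMatrix.IsSMatrix r ↔
        SMatrix.IsMaurerCartan (SMatrix.sBracketTotal K g) (SMatrix.toCochain r)) ∧
      ∀ α₁ α₂ α₃ : Module.Dual K g,
        (SMatrix.sBracket K g 1 1 (SMatrix.toCochain r) (SMatrix.toCochain r)).eval ![α₁, α₂] α₃ =
          -2 * SMatrix.evalTriple (SMatrix.sTensor r) α₁ α₂ α₃ := by
  exact ⟨SMatrix.isGradedLieBracket_sBracketTotal, fun r hr =>
    ⟨SMatrix.isSMatrix_iff hr, SMatrix.eval_sBracket_eq hr⟩⟩
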